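/- Throughout, $\mathbb N=\{1,2,3,\dots\}$ and $\mathbb N_0=\mathbb N\cup\{0\}$. Let $c,L\in[0,\infty)$, $\lambda\in(L,\infty)$, let $M\in\mathbb N$ satisfy $M>(\sqrt\lambda+\sqrt L)^2(\sqrt\lambda-\sqrt L)^{-2}$, and let $\Theta=\bigcup_{n\in\mathbb N}\mathbb Z^n$, where $0\in\mathbb Z=\mathbb Z^1$ is viewed as an element of $\Theta$ and where for $\theta\in\mathbb Z^n$ and $k,m\in\mathbb Z$ we write $(\theta,k,m)\in\mathbb Z^{n+2}$. For every $d\in\mathbb N$ let $u_d\in C^2(\mathbb R^d,\mathbb R)$ and $f_d\in C(\mathbb R^d\times\mathbb R,\mathbb R)$ satisfy for all $x=(x_1,\dots,x_d)\in\mathbb R^d$, $v,w\in\mathbb R$, $\varepsilon\in(0,\infty)$ that $$(\Delta u_d)(x)=f_d(x,u_d(x)),\qquad |f_d(x,v)-f_d(x,w)-\lambda(v-w)|\le L|v-w|,$$ $$|f_d(x,0)|\le c\,d^c\Big[1+\sum_{j=1}^d|x_j|\Big]^c,\qquad \sup_{y\in\mathbb R^d}\Big[|u_d(y)|\exp\Big(-\varepsilon\sum_{j=1}^d|y_j|\Big)\Big]<\infty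 .$$ Let $(\Omega,\mathcal F,\mathbb P)$ be a probability space. Let $W^{d,\theta}\colon[0,\infty)\times\Omega\to\mathbb R^d$, $\theta\in\Theta$, $d\in\mathbb N$, be standard ($d$-dimensional) Brownian motions (with almost surely continuous paths) such that for every $d\in\mathbb N$ the processes $W^{d,\theta}$, $\theta\in\Theta$, are independent; let $R^\theta\colon\Omega\to[0,\infty)$, $\theta\in\Theta$, be i.i.d. random variables with $\mathbb P(R^0\ge\varepsilon)=e^{-\lambda\varepsilon}$ for all $\varepsilon\in(0,\infty)$; and assume that the families $(R^\theta)_{\theta\in\Theta}$ and $(W^{d,\theta})_{(d,\theta)\in\mathbb N\times\Theta}$ are independent of each other. Let $U^{d,\theta}_n\colon\mathbb R^d\times\Omega\to\mathbb R$, $d\in\mathbb N$, $\theta\in\Theta$, $n\in\mathbb N_0$, be the functions which satisfy for all $d,n\in\mathbb N$, $\theta\in\Theta$, $x\in\mathbb R^d$ that $U^{d,\theta}_0(x)=0$ and, with the abbreviation $X_{k,m}=x+\sqrt2\,W^{d,(\theta,k,m)}_{R^{(\theta,k,m)}}$, $$U^{d,\theta}_n(x)=\frac{-1}{\lambda M^n}\sum_{m=1}^{M^n}f_d(X_{0,m},0)+\sum_{k=1}^{n-1}\frac1{\lambda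 M^{n-k}}\sum_{m=1}^{M^{n-k}}\Big(\lambda\big[U^{d,(\theta,k,m)}_k(X_{k,m})-U^{d,(\theta,k,-m)}_{k-1}(X_{k,m})\big]-\big[f_d\big(X_{k,m},U^{d,(\theta,k,m)}_k(X_{k,m})\big)-f_d\big(X_{k,m},U^{d,(\theta,k,-m)}_{k-1}(X_{k,m})\big)\big]\Big).$$ Let $\mathfrak C_{d,n}\in\mathbb R$, $d,n\in\mathbb N_0$, satisfy for all $d,n\in\mathbb N_0$ that $$\mathfrak C_{d,n}\le(d+1)M^n+\sum_{k=1}^{n-1}M^{n-k}\big(d+1+\mathfrak C_{d,k}+\mathfrak C_{d,k-1}\big)$$ (for $n\ge1$, $\mathfrak C_{d,n}$ models the cost of sampling one realization of $U^{d,0}_n(x)$). Then there exist $\kappa\in\mathbb R$ and $\mathfrak N\colon(0,1]\times\mathbb N\to\mathbb N$ such that for all $\varepsilon\in(0,1]$, $d\in\mathbb N$ it holds that $$\mathfrak C_{d,\mathfrak N_{\varepsilon,d}}\le\kappa\,d^\kappa\varepsilon^{-\kappa}\qquad\text{and}\qquad\sup_{x\in[-c,c]^d}\Big(\mathbb E\Big[\big|u_d(x)-U^{d,0}_{\mathfrak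 N_{\varepsilon,d}}(x)\big|^2\Big]\Big)^{1/2}\le\varepsilon .$$ -/

import Mathlib

open MeasureTheory ProbabilityTheory
open scoped NNReal

namespace EllipticMLP

/-- The index set `Θ = ⋃_{n ≥ 1} ℤⁿ` of nonempty finite tuples of integers. -/
abbrev Index : Type := {l : List ℤ // l ≠ []}

/-- The index `0 ∈ ℤ¹ ⊆ Θ`. -/
def Index.zero : Index := ⟨[0], by simp⟩

/-- The index `(θ, k, m) ∈ ℤⁿ⁺²` for `θ ∈ ℤⁿ` and `k, m ∈ ℤ`. -/
def Index.extend (θ : Index) (k m : ℤ) : Index := ⟨θ.1 ++ [k, m], by simp⟩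

/-- `W : [0,∞) × Ω → ℝᵈ` is a standard `d`-dimensional Brownian motion: a stochastic process
whose coordinate processes are independent real standard Brownian motions (with almost surely
continuous paths). -/
structure IsStandardBrownianMotion {Ω : Type*} [MeasurableSpace Ω] {d : ℕ}
    (W : ℝ≥0 → Ω → EuclideanSpace ℝ (Fin d)) (P : Measure Ω) : Prop where
  measurable : ∀ t, Measurable (W t)
  coord : ∀ i, IsBrownianReal (fun t ω => W t ω i) P
  indep : iIndepFun (fun (i : Fin d) (ω : Ω) (t : ℝ≥0) => W t ω i) P

/-- The point `x + √2 W_R`, where `W` is evaluated at the random time `R`. -/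
noncomputable def samplePoint {Ω : Type*} {d : ℕ} (W : ℝ≥0 → Ω → EuclideanSpace ℝ (Fin d))
    (R : Ω → ℝ≥0) (x : EuclideanSpace ℝ (Fin d)) (ω : Ω) : EuclideanSpace ℝ (Fin d) :=
  x + √2 • W (R ω) ω

/-- `U θ n x ω` is the full-history recursive multilevel Picard approximation `U^θ_n(x)(ω)` for
the nonlinearity `f`, the parameter `lam`, the basis `M` of the Monte Carlo sample numbers, and
the driving processes `W^θ` and random times `R^θ`. The two conditions determine `U` uniquely. -/
structure IsMLPScheme {Ω : Type*} {d : ℕ} (lam : ℝ) (M : ℕ)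
    (f : EuclideanSpace ℝ (Fin d) → ℝ → ℝ)
    (W : Index → ℝ≥0 → Ω → EuclideanSpace ℝ (Fin d)) (R : Index → Ω → ℝ≥0)
    (U : Index → ℕ → EuclideanSpace ℝ (Fin d) → Ω → ℝ) : Prop where
  zero : ∀ θ x ω, U θ 0 x ω = 0
  step : ∀ (n : ℕ), 1 ≤ n → ∀ (θ : Index) (x : EuclideanSpace ℝ (Fin d)) (ω : Ω),
    let X : ℕ → ℕ → EuclideanSpace ℝ (Fin d) := fun k m =>
      samplePoint (W (θ.extend k m)) (R (θ.extend k m)) x ω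
    U θ n x ω =
      (-1) / (lam * (M : ℝ) ^ n) * ∑ m ∈ Finset.Icc 1 (M ^ n), f (X 0 m) 0
      + ∑ k ∈ Finset.Ico 1 n, 1 / (lam * (M : ℝ) ^ (n - k)) *
          ∑ m ∈ Finset.Icc 1 (M ^ (n - k)),
            (lam * (U (θ.extend k m) k (X k m) ω - U (θ.extend k (-m)) (k - 1) (X k m) ω)
              - (f (X k m) (U (θ.extend k m) k (X k m) ω)
                  - f (X k m) (U (θ.extend k (-m)) (k - 1) (X k m) ω)))

end EllipticMLP

namespace EllipticMLP

/-! ### The scheme as a deterministic functional of the noise -/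

/-! Put `G x v = v - f x v / lam`. The structural condition on `f` says that `G` is Lipschitz in `v`
with constant `a = L / lam < 1`. Since `Δu = f(·, u)`, writing `u` as the resolvent `lam (lam -
Δ)⁻¹` applied to `u - Δu / lam` gives the fixed point equation `u(x) = E[G(X, u(X))]` with `X = x +
√2 W_R`, because the law of `√2 W_R` is the resolvent kernel (`eq_integral_resolventMeasure`). The
scheme is a telescoped Monte Carlo version of Picard iteration for this equation.

Errors at `x` are measured in `L²(P)` relative to `√ρ(x)`, where `ρ(x) = ∑ⱼ cosh(ε xⱼ)`. As `Δρ = ε²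
ρ`, one has `E[ρ(X)] = A ρ(x)` with `A = lam / (lam - ε²)`, in every dimension. Averaging over `X`
therefore costs a factor `√A`, and one Picard step contracts by `b = a √A`. With `q = 1 / √M`,
splitting the error into bias and statistical errors of independent samples gives `e_{n+1} ≤ K
q^{n+1} + ∑_{1 ≤ k ≤ n} q^{n+1-k} b (e_k + e_{k-1}) + b e_n`, which is solved by a multiple of `r^n`
with `r = (1 + q)(1 + b) - 1` (`eLpNorm_mlp_sub_le`). The assumption on `M` yields `r < 1` for small
`ε` (`exists_weight_parameter`).

The prefactor must be polynomial in `d`. The growth assumption on `u` only gives a bound with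
uncontrolled dependence on `d`, but iterating the contraction replaces it by one depending on `f(·,
0)` alone (`abs_le_of_fixed_point`). The weight dominates `|f(·, 0)|` up to `d^(2c)`, and `√ρ` is of
order `√d` on the cube. Since the cost is at most `(d + 1)(4M)^n`, choosing `n` logarithmic in
`d^(2c+1/2) / ε` finishes the proof (`exists_polynomial_rate`). -/

/-- The index `(k, m)` followed by `l`. -/
def Index.child (k m : ℤ) (l : List ℤ) : Index := ⟨k :: m :: l, by simp⟩

/-- The noise seen by the subtree with root `(k, m)`. -/
def shift {E : Type*} (k m : ℤ) (s : Index → E) : Index → E := fun l => s (Index.child k m l.1)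

/-- The multilevel Picard approximation driven by the noise `s` attached to the descendants of
the current index. Here `G x v = v - f x v / lam`. -/
noncomputable def mlp {E : Type*} [Add E] (M : ℕ) (G : E → ℝ → ℝ) :
    ℕ → E → (Index → E) → ℝ
  | n => fun x s => if n = 0 then 0 else
      ((M : ℝ) ^ n)⁻¹ * ∑ m ∈ Finset.Icc 1 (M ^ n), G (x + s (Index.child 0 m [])) 0
      + ∑ k ∈ (Finset.Ico 1 n).attach, ((M : ℝ) ^ (n - k.1))⁻¹ *
          ∑ m ∈ Finset.Icc 1 (M ^ (n - k.1)),
            (G (x + s (Index.child k.1 m []))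
                (mlp M G k.1 (x + s (Index.child k.1 m [])) (shift k.1 m s))
              - G (x + s (Index.child k.1 m []))
                (mlp M G (k.1 - 1) (x + s (Index.child k.1 m [])) (shift k.1 (-m) s)))
termination_by n => n
decreasing_by
  · exact (Finset.mem_Ico.1 k.2).2
  · have := Finset.mem_Ico.1 k.2
    omega

section scheme

variable {E : Type*} [Add E] {M : ℕ} {G : E → ℝ → ℝ}

@[simp] lemma mlp_zero (x : E) (s : Index → E) : mlp M G 0 x s = 0 := by
  rw [mlp]; simp

lemma mlp_of_pos {n : ℕ} (hn : 1 ≤ n) (x : E) (s : Index → E) :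
    mlp M G n x s =
      ((M : ℝ) ^ n)⁻¹ * ∑ m ∈ Finset.Icc 1 (M ^ n), G (x + s (Index.child 0 m [])) 0
      + ∑ k ∈ Finset.Ico 1 n, ((M : ℝ) ^ (n - k))⁻¹ *
          ∑ m ∈ Finset.Icc 1 (M ^ (n - k)),
            (G (x + s (Index.child k m []))
                (mlp M G k (x + s (Index.child k m [])) (shift k m s))
              - G (x + s (Index.child k m []))
                (mlp M G (k - 1) (x + s (Index.child k m [])) (shift k (-m) s))) := by
  rw [mlp]
  beta_reduce
  rw [if_neg (by omega)]
  congr 1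
  exact Finset.sum_attach (Finset.Ico 1 n) (fun k => ((M : ℝ) ^ (n - k))⁻¹ *
          ∑ m ∈ Finset.Icc 1 (M ^ (n - k)),
            (G (x + s (Index.child k m []))
                (mlp M G k (x + s (Index.child k m [])) (shift k m s))
              - G (x + s (Index.child k m []))
                (mlp M G (k - 1) (x + s (Index.child k m [])) (shift k (-m) s))))

end scheme

/-- A multilevel Picard scheme is the functional `mlp` of the noise below its index. -/
lemma IsMLPScheme.eq_mlp {Ω : Type*} {d : ℕ} {lam : ℝ} (hlam : lam ≠ 0) {M : ℕ}
    {f : EuclideanSpace ℝ (Fin d) → ℝ → ℝ}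
    {W : Index → ℝ≥0 → Ω → EuclideanSpace ℝ (Fin d)} {R : Index → Ω → ℝ≥0}
    {U : Index → ℕ → EuclideanSpace ℝ (Fin d) → Ω → ℝ} (hU : IsMLPScheme lam M f W R U)
    (n : ℕ) : ∀ (θ : Index) (x : EuclideanSpace ℝ (Fin d)) (ω : Ω),
      U θ n x ω = mlp M (fun y v => v - f y v / lam) n x
        (fun l => √2 • W ⟨θ.1 ++ l.1, by simp [θ.2]⟩ (R ⟨θ.1 ++ l.1, by simp [θ.2]⟩ ω) ω) := by
  induction n using Nat.strong_induction_on with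
  | _ n ih =>
    intro θ x ω
    rcases Nat.eq_zero_or_pos n with rfl | hn
    · rw [hU.zero, mlp_zero]
    have hX : ∀ k m : ℤ, samplePoint (W (θ.extend k m)) (R (θ.extend k m)) x ω
        = x + √2 • W ⟨θ.1 ++ (Index.child k m []).1, by simp [θ.2]⟩
          (R ⟨θ.1 ++ (Index.child k m []).1, by simp [θ.2]⟩ ω) ω := fun k m => rfl
    -- The noise below `θ.extend k m` is the `(k, m)`-shift of the noise below `θ`, by associativity
    -- of list concatenation; this is what lets the induction close.
    have hshift : ∀ k m : ℤ, (fun l : Index => √2 • W ⟨(θ.extend k m).1 ++ l.1, by simp [l.2]⟩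
          (R ⟨(θ.extend k m).1 ++ l.1, by simp [l.2]⟩ ω) ω)
        = shift k m (fun l : Index => √2 • W ⟨θ.1 ++ l.1, by simp [l.2]⟩
          (R ⟨θ.1 ++ l.1, by simp [l.2]⟩ ω) ω) := by
      intro k m
      funext l
      have : ∀ (l₁ l₂ : List ℤ) (h₁ : l₁ ≠ []) (h₂ : l₂ ≠ []), l₁ = l₂ →
          W ⟨l₁, h₁⟩ (R ⟨l₁, h₁⟩ ω) ω = W ⟨l₂, h₂⟩ (R ⟨l₂, h₂⟩ ω) ω := by
        rintro l₁ _ h₁ h₂ rfl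
        rfl
      simp only [shift]
      rw [this _ _ _ _ _]
      simp [Index.extend, Index.child]
    rw [hU.step n hn, mlp_of_pos hn]
    simp only
    congr 1
    · rw [Finset.mul_sum, Finset.mul_sum]
      refine Finset.sum_congr rfl fun m _ => ?_
      rw [hX]
      simp only [Nat.cast_zero]
      field_simp
      ring
    · refine Finset.sum_congr rfl fun k hk => ?_
      have hk' := Finset.mem_Ico.1 hk
      rw [Finset.mul_sum, Finset.mul_sum]
      refine Finset.sum_congr rfl fun m _ => ?_
      rw [ih k hk'.2, ih (k - 1) (by omega), hshift, hshift, hX]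
      field_simp
      ring

section measurability

variable {E : Type*} [MeasurableSpace E]

@[fun_prop] lemma measurable_shift (k m : ℤ) : Measurable (shift (E := E) k m) :=
  measurable_pi_lambda _ fun _ => measurable_pi_apply _

variable [Add E] [MeasurableAdd₂ E] {M : ℕ} {G : E → ℝ → ℝ}

lemma measurable_mlp (hG : Measurable (Function.uncurry G)) (n : ℕ) :
    Measurable (fun p : E × (Index → E) => mlp M G n p.1 p.2) := by
  induction n using Nat.strong_induction_on with
  | _ n ih =>
    rcases Nat.eq_zero_or_pos n with rfl | hn
    · simp only [mlp_zero]
      exact measurable_const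
    have hadd : ∀ k m : ℤ, Measurable fun p : E × (Index → E) =>
        p.1 + p.2 (Index.child k m []) := fun k m =>
      measurable_fst.add ((measurable_pi_apply _).comp measurable_snd)
    have hterm : ∀ j < n, ∀ k m m' : ℤ, Measurable fun p : E × (Index → E) =>
        G (p.1 + p.2 (Index.child k m []))
          (mlp M G j (p.1 + p.2 (Index.child k m [])) (shift k m' p.2)) := fun j hj k m m' =>
      hG.comp ((hadd k m).prodMk ((ih j hj).comp
        ((hadd k m).prodMk ((measurable_shift k m').comp measurable_snd))))
    simp only [mlp_of_pos hn]
    refine Measurable.add ?_ ?_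
    · refine Measurable.const_mul (Finset.measurable_sum _ fun m _ => ?_) _
      exact hG.comp ((hadd 0 m).prodMk measurable_const)
    · refine Finset.measurable_sum _ fun k hk => ?_
      have hk' := Finset.mem_Ico.1 hk
      refine Measurable.const_mul (Finset.measurable_sum _ fun m _ => ?_) _
      exact (hterm k hk'.2 k m m).sub (hterm (k - 1) (by omega) k m (-m))

end measurability

/-! ### Independence of disjoint parts of the noise -/

/-- The coordinates of a product measure are independent, so the σ-algebras generated by two
disjoint sets of coordinates are independent. All independence used in the error analysis reduces to
checking that two sets of indices do not meet. -/
lemma indepFun_restrict_infinitePi {ι κ₁ κ₂ E : Type*} [MeasurableSpace E] (μ : Measure E)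
    [IsProbabilityMeasure μ] (j₁ : κ₁ → ι) (j₂ : κ₂ → ι) (h : ∀ a b, j₁ a ≠ j₂ b) :
    IndepFun (fun (s : ι → E) a => s (j₁ a)) (fun (s : ι → E) b => s (j₂ b))
      (Measure.infinitePi fun _ : ι => μ) := by
  have hind : iIndepFun (fun (i : ι) (s : ι → E) => s i) (Measure.infinitePi fun _ : ι => μ) :=
    iIndepFun_infinitePi (X := fun _ x => x) fun _ => measurable_id
  have hdisj : Disjoint (Set.range j₁) (Set.range j₂) := by
    rw [Set.disjoint_left]
    rintro _ ⟨a, rfl⟩ ⟨b, hb⟩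
    exact h a b hb.symm
  have key := indep_iSup_of_disjoint (fun i => (measurable_pi_apply i).comap_le) hind.iIndep hdisj
  refine indep_of_indep_of_le_left (indep_of_indep_of_le_right key ?_) ?_
  all_goals
    simp only [MeasurableSpace.pi, MeasurableSpace.comap_iSup, MeasurableSpace.comap_comp]
    refine iSup_le fun a => ?_
    exact le_iSup₂_of_le (f := fun i _ => MeasurableSpace.comap (fun s : ι → E => s i) _) _
      ⟨a, rfl⟩ le_rfl

/-! ### Law and independence of the samples within one level -/

section branch

variable {E : Type*} [MeasurableSpace E]

/-- The increment attached to `(k, m)` and the noise of the two subtrees with roots `(k, m)` and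
`(k, -m)`. -/
def branch (k m : ℤ) (s : Index → E) : E × (Index → E) × (Index → E) :=
  (s (Index.child k m []), shift k m s, shift k (-m) s)

@[fun_prop] lemma measurable_branch (k m : ℤ) : Measurable (branch (E := E) k m) :=
  (measurable_pi_apply _).prodMk ((measurable_shift k m).prodMk (measurable_shift k (-m)))

variable (μ : Measure E) [IsProbabilityMeasure μ]

/-- Prefixing indices is injective, so a subtree carries a copy of the whole noise. This
self-similarity makes the error estimate recursive. -/
lemma map_shift (k m : ℤ) : (Measure.infinitePi fun _ : Index => μ).map (shift k m)
    = Measure.infinitePi fun _ : Index => μ :=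
  Measure.map_infinitePi_infinitePi_of_inj (P := fun _ : Index => μ)
    (f := fun l : Index => Index.child k m l.1) fun l l' h => by
      simpa [Index.child, Subtype.ext_iff] using h

/-- The three components read disjoint coordinates: `1 ≤ m` separates `m` from `-m`, and `shift`
only sees nonempty continuations, hence never the increment at `(k, m)` itself. -/
lemma map_branch (k : ℤ) {m : ℤ} (hm : 1 ≤ m) :
    (Measure.infinitePi fun _ : Index => μ).map (branch k m)
      = μ.prod ((Measure.infinitePi fun _ : Index => μ).prod
          (Measure.infinitePi fun _ : Index => μ)) := by
  have h₁ : IndepFun (shift (E := E) k m) (shift k (-m)) (Measure.infinitePi fun _ : Index => μ) :=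
    indepFun_restrict_infinitePi μ (fun l : Index => Index.child k m l.1)
      (fun l : Index => Index.child k (-m) l.1) fun l l' h => by
        simp only [Index.child, Subtype.mk.injEq, List.cons.injEq] at h
        omega
  have h₂ := indepFun_restrict_infinitePi μ (fun _ : Unit => Index.child k m [])
      (fun p : Index × Bool => Index.child k (if p.2 then m else -m) p.1.1) fun l l' h => by
        simp only [Index.child, Subtype.mk.injEq, List.cons.injEq] at h
        exact l'.1.2 h.2.2.symm
  have h₃ : IndepFun (fun s : Index → E => s (Index.child k m []))
      (fun s => (shift k m s, shift k (-m) s)) (Measure.infinitePi fun _ : Index => μ) := by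
    have hφ : Measurable fun z : Unit → E => z () := measurable_pi_apply ()
    refine h₂.comp (φ := fun z : Unit → E => z ())
      (ψ := fun z => ((fun l => z (l, true)), fun l => z (l, false))) hφ ?_
    exact (measurable_pi_lambda _ fun _ => measurable_pi_apply _).prodMk
      (measurable_pi_lambda _ fun _ => measurable_pi_apply _)
  unfold branch
  rw [h₃.map_prod_eq_prod_map_map (measurable_pi_apply _).aemeasurable
      ((measurable_shift k m).prodMk (measurable_shift k (-m))).aemeasurable,
    h₁.map_prod_eq_prod_map_map (measurable_shift _ _).aemeasurable
      (measurable_shift _ _).aemeasurable, map_shift, map_shift, Measure.infinitePi_map_eval]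

/-- Distinct positive `m`, `m'` give disjoint pairs `{m, -m}` and `{m', -m'}`. Empty continuations
are allowed here in order to include the increments. -/
lemma indepFun_branch (k : ℤ) {m m' : ℤ} (hm : 1 ≤ m) (hm' : 1 ≤ m') (h : m ≠ m') :
    IndepFun (branch (E := E) k m) (branch k m') (Measure.infinitePi fun _ : Index => μ) := by
  have h₂ := indepFun_restrict_infinitePi μ
      (fun p : List ℤ × Bool => Index.child k (if p.2 then m else -m) p.1)
      (fun p : List ℤ × Bool => Index.child k (if p.2 then m' else -m') p.1) fun l l' h => by
        simp only [Index.child, Subtype.mk.injEq, List.cons.injEq] at h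
        grind
  have hφ : Measurable fun z : List ℤ × Bool → E =>
      (z ([], true), (fun l : Index => z (l.1, true)), fun l : Index => z (l.1, false)) :=
    (measurable_pi_apply _).prodMk ((measurable_pi_lambda _ fun _ => measurable_pi_apply _).prodMk
      (measurable_pi_lambda _ fun _ => measurable_pi_apply _))
  exact h₂.comp hφ hφ

end branch

end EllipticMLP

namespace EllipticMLP

/-! ### `L²` estimates -/

section Ltwo

variable {α : Type*} [MeasurableSpace α] {P : Measure α}

lemma eLpNorm_two_le_iff {f : α → ℝ} {B : ℝ} (hB : 0 ≤ B) :
    eLpNorm f 2 P ≤ ENNReal.ofReal B ↔ ∫⁻ x, ‖f x‖ₑ ^ 2 ∂P ≤ ENNReal.ofReal (B ^ 2) := by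
  rw [eLpNorm_eq_lintegral_rpow_enorm_toReal two_ne_zero ENNReal.ofNat_ne_top,
    ENNReal.ofReal_pow hB]
  simp only [ENNReal.toReal_ofNat, ENNReal.rpow_ofNat, one_div]
  rw [ENNReal.rpow_inv_le_iff two_pos, ENNReal.rpow_ofNat]

lemma integral_sq_le_of_eLpNorm_le {f : α → ℝ} {B : ℝ} (hB : 0 ≤ B)
    (hf : AEStronglyMeasurable f P) (h : eLpNorm f 2 P ≤ ENNReal.ofReal B) :
    ∫ x, f x ^ 2 ∂P ≤ B ^ 2 := by
  rw [eLpNorm_two_le_iff hB] at h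
  rw [integral_eq_lintegral_of_nonneg_ae (Filter.Eventually.of_forall fun x => sq_nonneg _)
    (hf.pow 2)]
  refine ENNReal.toReal_le_of_le_ofReal (sq_nonneg B) (le_trans (le_of_eq ?_) h)
  refine lintegral_congr fun x => ?_
  rw [Real.enorm_eq_ofReal_abs, ← ENNReal.ofReal_pow (abs_nonneg _), sq_abs]

lemma abs_integral_le_of_eLpNorm_two_le [IsProbabilityMeasure P] {f : α → ℝ} {B : ℝ} (hB : 0 ≤ B)
    (hf : AEStronglyMeasurable f P) (h : eLpNorm f 2 P ≤ ENNReal.ofReal B) :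
    |∫ x, f x ∂P| ≤ B := by
  have h1 : eLpNorm f 1 P ≤ ENNReal.ofReal B :=
    (eLpNorm_le_eLpNorm_of_exponent_le one_le_two hf).trans h
  rw [eLpNorm_one_eq_lintegral_enorm] at h1
  have h2 := (enorm_integral_le_lintegral_enorm f (μ := P)).trans h1
  rw [Real.enorm_eq_ofReal_abs] at h2
  exact (ENNReal.ofReal_le_ofReal_iff hB).1 h2

lemma eLpNorm_two_const [IsProbabilityMeasure P] (c : ℝ) :
    eLpNorm (fun _ : α => c) 2 P = ENNReal.ofReal |c| := by
  rw [eLpNorm_const _ two_ne_zero (NeZero.ne _)]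
  simp [Real.enorm_eq_ofReal_abs]

lemma integral_comp_measurePreserving {β : Type*} [MeasurableSpace β] {Q : Measure β} {φ : α → β}
    (hφ : MeasurePreserving φ P Q) {g : β → ℝ} (hg : Measurable g) :
    ∫ x, g (φ x) ∂P = ∫ y, g y ∂Q := by
  rw [← hφ.map_eq, integral_map hφ.measurable.aemeasurable hg.aestronglyMeasurable]

/-- The Monte Carlo rate: the `L²` error of the average of pairwise independent variables. -/
lemma eLpNorm_average_sub_integral_le [IsProbabilityMeasure P] {ι : Type*} (s : Finset ι)
    (hs : s.Nonempty) (Z : ι → α → ℝ) (hZm : ∀ i ∈ s, Measurable (Z i))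
    (hind : Set.Pairwise (s : Set ι) fun i j => IndepFun (Z i) (Z j) P) {B : ℝ} (hB : 0 ≤ B)
    (hZ : ∀ i ∈ s, eLpNorm (Z i) 2 P ≤ ENNReal.ofReal B) {c : ℝ}
    (hc : ∀ i ∈ s, ∫ x, Z i x ∂P = c) :
    eLpNorm (fun x => (s.card : ℝ)⁻¹ * ∑ i ∈ s, Z i x - c) 2 P
      ≤ ENNReal.ofReal ((√s.card)⁻¹ * B) := by
  have hcard : (0 : ℝ) < s.card := by exact_mod_cast hs.card_pos
  have hmem : ∀ i ∈ s, MemLp (Z i) 2 P := fun i hi =>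
    ⟨(hZm i hi).aestronglyMeasurable, (hZ i hi).trans_lt ENNReal.ofReal_lt_top⟩
  have hmemS : MemLp (∑ i ∈ s, Z i) 2 P := memLp_finsetSum' s hmem
  have hmemA : MemLp (fun x => (s.card : ℝ)⁻¹ * (∑ i ∈ s, Z i) x) 2 P := hmemS.const_mul _
  have hmean : ∫ x, (s.card : ℝ)⁻¹ * (∑ i ∈ s, Z i) x ∂P = c := by
    simp only [Finset.sum_apply]
    rw [integral_const_mul, integral_finsetSum s fun i hi =>
      (hmem i hi).integrable one_le_two, Finset.sum_congr rfl hc, Finset.sum_const, nsmul_eq_mul]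
    field_simp
  rw [eLpNorm_two_le_iff (by positivity)]
  have hev : ∫⁻ x, ‖(s.card : ℝ)⁻¹ * ∑ i ∈ s, Z i x - c‖ₑ ^ 2 ∂P
      = evariance (fun x => (s.card : ℝ)⁻¹ * (∑ i ∈ s, Z i) x) P := by
    rw [evariance, hmean]
    simp only [Finset.sum_apply]
  rw [hev, ← hmemA.ofReal_variance_eq]
  refine ENNReal.ofReal_le_ofReal ?_
  rw [variance_const_mul, IndepFun.variance_sum hmem hind]
  have hvar : ∀ i ∈ s, variance (Z i) P ≤ B ^ 2 := fun i hi =>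
    (variance_le_expectation_sq (hmem i hi).1).trans
      (integral_sq_le_of_eLpNorm_le hB (hmem i hi).1 (hZ i hi))
  calc ((s.card : ℝ)⁻¹) ^ 2 * ∑ i ∈ s, variance (Z i) P
      ≤ ((s.card : ℝ)⁻¹) ^ 2 * ∑ _i ∈ s, B ^ 2 := by
        gcongr with i hi
        exact hvar i hi
    _ = ((√s.card)⁻¹ * B) ^ 2 := by
        rw [Finset.sum_const, nsmul_eq_mul, mul_pow, inv_pow, inv_pow, Real.sq_sqrt hcard.le]
        field_simp

/-- Averaging a random field over a random shift in a weighted `L²` norm. -/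
lemma eLpNorm_two_comp_add_le {E S : Type*} [MeasurableSpace E] [Add E] [MeasurableAdd₂ E]
    [MeasurableSpace S] (μ : Measure E) [IsProbabilityMeasure μ] (ν : Measure S)
    [IsProbabilityMeasure ν] {ρ : E → ℝ} (hρ : ∀ x, 0 ≤ ρ x)
    {A : ℝ} (hA : 0 ≤ A) (hAρ : ∀ x, ∫⁻ y, ENNReal.ofReal (ρ (x + y)) ∂μ ≤ ENNReal.ofReal (A * ρ x))
    {V : E × S → ℝ} (hV : Measurable V) {e : ℝ} (he : 0 ≤ e)
    (h : ∀ x, eLpNorm (fun s => V (x, s)) 2 ν ≤ ENNReal.ofReal (e * √(ρ x))) (x : E) :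
    eLpNorm (fun p : E × S => V (x + p.1, p.2)) 2 (μ.prod ν)
      ≤ ENNReal.ofReal (√A * e * √(ρ x)) := by
  rw [eLpNorm_two_le_iff (by positivity)]
  have hm : Measurable fun p : E × S => V (x + p.1, p.2) :=
    hV.comp ((measurable_fst.const_add x).prodMk measurable_snd)
  rw [lintegral_prod _ (hm.enorm.pow_const 2).aemeasurable]
  calc ∫⁻ y, ∫⁻ s, ‖V (x + y, s)‖ₑ ^ 2 ∂ν ∂μ
      ≤ ∫⁻ y, ENNReal.ofReal (e ^ 2) * ENNReal.ofReal (ρ (x + y)) ∂μ := by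
        refine lintegral_mono fun y => ?_
        have := (eLpNorm_two_le_iff (by positivity)).1 (h (x + y))
        rwa [mul_pow, Real.sq_sqrt (hρ _), ENNReal.ofReal_mul (by positivity)] at this
    _ = ENNReal.ofReal (e ^ 2) * ∫⁻ y, ENNReal.ofReal (ρ (x + y)) ∂μ :=
        lintegral_const_mul' _ _ ENNReal.ofReal_ne_top
    _ ≤ ENNReal.ofReal (e ^ 2) * ENNReal.ofReal (A * ρ x) := by gcongr; exact hAρ x
    _ = ENNReal.ofReal ((√A * e * √(ρ x)) ^ 2) := by
        rw [← ENNReal.ofReal_mul (by positivity), mul_pow, mul_pow, Real.sq_sqrt hA,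
          Real.sq_sqrt (hρ _)]
        ring_nf

end Ltwo

/-! ### The error recursion -/

/-- The sequence `D r ^ n` with `r = (1 + q) (1 + b) - 1` is a supersolution of the error
recursion. -/
lemma error_recursion_geometric_le {b q K D : ℝ} (hb : 0 ≤ b) (hq : 0 ≤ q) (hK : K ≤ D)
    (hD : 0 ≤ D) (n : ℕ) :
    K * q ^ (n + 1) + ∑ k ∈ Finset.Ico 1 (n + 1), q ^ (n + 1 - k) *
        (b * (D * ((1 + q) * (1 + b) - 1) ^ k + D * ((1 + q) * (1 + b) - 1) ^ (k - 1)))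
      + b * (D * ((1 + q) * (1 + b) - 1) ^ n)
      ≤ D * ((1 + q) * (1 + b) - 1) ^ (n + 1) := by
  set r := (1 + q) * (1 + b) - 1 with hr
  -- The powers of `r` satisfy the recursion exactly up to the term `(1 + b) q ^ (n + 1)`; after
  -- multiplication by `D` this slack absorbs the forcing term, because `K ≤ D`.
  have hid : ∀ n : ℕ, b * r ^ n
      + ∑ k ∈ Finset.Ico 1 (n + 1), q ^ (n + 1 - k) * (b * (r ^ k + r ^ (k - 1)))
      = r ^ (n + 1) - (1 + b) * q ^ (n + 1) := by
    intro n
    induction n with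
    | zero => simp [hr]; ring
    | succ n ih =>
      rw [Finset.sum_Ico_succ_top (by omega)]
      have : ∑ k ∈ Finset.Ico 1 (n + 1), q ^ (n + 1 + 1 - k) * (b * (r ^ k + r ^ (k - 1)))
          = q * ∑ k ∈ Finset.Ico 1 (n + 1), q ^ (n + 1 - k) * (b * (r ^ k + r ^ (k - 1))) := by
        rw [Finset.mul_sum]
        refine Finset.sum_congr rfl fun k hk => ?_
        have := Finset.mem_Ico.1 hk
        rw [show n + 1 + 1 - k = (n + 1 - k) + 1 by omega, pow_succ]
        ring
      rw [this]
      have h2 : n + 1 + 1 - (n + 1) = 1 := by omega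
      rw [h2, Nat.add_sub_cancel]
      have h3 : r ^ (n + 1 + 1) = ((1 + q) * (1 + b) - 1) * r ^ (n + 1) := by rw [pow_succ, hr]; ring
      linear_combination q * ih - h3
  have hsum : ∑ k ∈ Finset.Ico 1 (n + 1), q ^ (n + 1 - k) * (b * (D * r ^ k + D * r ^ (k - 1)))
      = D * ∑ k ∈ Finset.Ico 1 (n + 1), q ^ (n + 1 - k) * (b * (r ^ k + r ^ (k - 1))) := by
    rw [Finset.mul_sum]
    exact Finset.sum_congr rfl fun k _ => by ring
  have h2 : K * q ^ (n + 1) ≤ D * ((1 + b) * q ^ (n + 1)) := by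
    have : (0 : ℝ) ≤ q ^ (n + 1) := by positivity
    nlinarith [mul_nonneg (mul_nonneg hD hb) this, mul_le_mul_of_nonneg_right hK this]
  rw [hsum]
  linear_combination h2 + D * hid n

section error

variable {E : Type*} [MeasurableSpace E] [Add E] [MeasurableAdd₂ E]
  (μ : Measure E) [IsProbabilityMeasure μ] {G : E → ℝ → ℝ} {u ρ : E → ℝ} {a A K C₀ : ℝ}

/-- A solution of the fixed point equation which is bounded by some multiple of the weight is
bounded by an explicit multiple of the weight. -/
lemma abs_le_of_fixed_point (hG : Measurable (Function.uncurry G)) (hu : Measurable u)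
    (hρ : ∀ x, 0 ≤ ρ x) (hA : 0 ≤ A) (ha : 0 ≤ a) (hC₀ : 0 ≤ C₀) (hK : 0 ≤ K)
    (hAρ : ∀ x, ∫⁻ y, ENNReal.ofReal (ρ (x + y)) ∂μ ≤ ENNReal.ofReal (A * ρ x))
    (hlip : ∀ x v w, |G x v - G x w| ≤ a * |v - w|)
    (hG0 : ∀ x, |G x 0| ≤ C₀ * √(ρ x)) (huK : ∀ x, |u x| ≤ K * √(ρ x))
    (hfix : ∀ x, u x = ∫ y, G (x + y) (u (x + y)) ∂μ) (hb : a * √A < 1) (x : E) :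
    |u x| ≤ C₀ * √A / (1 - a * √A) * √(ρ x) := by
  set D := C₀ * √A / (1 - a * √A) with hD
  have h1b : 0 < 1 - a * √A := by linarith
  have hD0 : 0 ≤ D := by positivity
  -- `D` is the fixed point of `κ ↦ √A (C₀ + a κ)`, the map which turns one bound `κ √ρ` on `|u|`
  -- into the next. Iteration from `D + K` approaches `D` at rate `a √A`, and the limit forgets `K`.
  have hDeq : √A * (C₀ + a * D) = D := by
    have : D * (1 - a * √A) = C₀ * √A := div_mul_cancel₀ _ h1b.ne'
    linear_combination -this
  have hGu : Measurable fun z => G z (u z) := hG.comp (measurable_id.prodMk hu)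
  have key : ∀ n : ℕ, ∀ x, |u x| ≤ (D + (a * √A) ^ n * K) * √(ρ x) := by
    intro n
    induction n with
    | zero =>
      intro x
      refine (huK x).trans ?_
      gcongr
      simpa using hD0
    | succ n ih =>
      intro x
      rw [hfix x]
      have hκ : 0 ≤ D + (a * √A) ^ n * K := by positivity
      -- A deterministic function is treated as a random field over a one-point probability space,
      -- so that the averaging estimate applies.
      have hV : ∀ z, eLpNorm (fun _ : Unit => G z (u z)) 2 (Measure.dirac ())
          ≤ ENNReal.ofReal ((C₀ + a * (D + (a * √A) ^ n * K)) * √(ρ z)) := by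
        intro z
        rw [eLpNorm_two_const]
        refine ENNReal.ofReal_le_ofReal ?_
        have h1 := hlip z (u z) 0
        have h2 := hG0 z
        have h3 := mul_le_mul_of_nonneg_left (ih z) ha
        have h4 : |G z (u z)| ≤ |G z (u z) - G z 0| + |G z 0| := by
          simpa using abs_add_le (G z (u z) - G z 0) (G z 0)
        rw [sub_zero] at h1
        nlinarith
      have h5 := eLpNorm_two_comp_add_le μ (Measure.dirac ()) hρ hA hAρ
        (V := fun p : E × Unit => G p.1 (u p.1)) (hGu.comp measurable_fst) (by positivity) hV x
      have h6 := abs_integral_le_of_eLpNorm_two_le (by positivity)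
        ((hGu.comp (measurable_fst.const_add x)).aestronglyMeasurable) h5
      have h7 : ∫ p : E × Unit, G (x + p.1) (u (x + p.1)) ∂(μ.prod (Measure.dirac ()))
          = ∫ y, G (x + y) (u (x + y)) ∂μ :=
        integral_comp_measurePreserving (measurePreserving_fst (μ := μ)
          (ν := Measure.dirac ())) (hGu.comp (measurable_const_add x))
      rw [← h7]
      refine h6.trans (le_of_eq ?_)
      congr 1
      rw [pow_succ]
      linear_combination hDeq
  have hlim : Filter.Tendsto (fun n : ℕ => (D + (a * √A) ^ n * K) * √(ρ x)) Filter.atTop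
      (nhds ((D + 0 * K) * √(ρ x))) :=
    ((((tendsto_pow_atTop_nhds_zero_of_lt_one (by positivity) hb).mul_const K).const_add
      D).mul_const _)
  simpa using ge_of_tendsto' hlim fun n => key n x

variable {M : ℕ}

/-- The error of the multilevel Picard approximations decays geometrically in a weighted `L²`
norm. -/
theorem eLpNorm_mlp_sub_le (hG : Measurable (Function.uncurry G)) (hu : Measurable u)
    (hρ : ∀ x, 0 ≤ ρ x) (hA : 0 ≤ A) (ha : 0 ≤ a) (hC₀ : 0 ≤ C₀) (hK : 0 ≤ K)
    (hAρ : ∀ x, ∫⁻ y, ENNReal.ofReal (ρ (x + y)) ∂μ ≤ ENNReal.ofReal (A * ρ x))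
    (hlip : ∀ x v w, |G x v - G x w| ≤ a * |v - w|)
    (hG0 : ∀ x, |G x 0| ≤ C₀ * √(ρ x)) (huK : ∀ x, |u x| ≤ K * √(ρ x))
    (hfix : ∀ x, u x = ∫ y, G (x + y) (u (x + y)) ∂μ) (hb : a * √A < 1) (hM : 1 ≤ M)
    (n : ℕ) : ∀ x : E,
    eLpNorm (fun s => mlp M G n x s - u x) 2 (Measure.infinitePi fun _ : Index => μ)
      ≤ ENNReal.ofReal (C₀ * √A / (1 - a * √A) *
          ((1 + (√M)⁻¹) * (1 + a * √A) - 1) ^ n * √(ρ x)) := by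
  set D := C₀ * √A / (1 - a * √A) with hD
  set r := (1 + (√M)⁻¹) * (1 + a * √A) - 1 with hr
  set ν := Measure.infinitePi fun _ : Index => μ with hν
  have h1b : 0 < 1 - a * √A := by linarith
  have hab : 0 ≤ a * √A := by positivity
  have hD0 : 0 ≤ D := by positivity
  have hq : 0 ≤ (√M)⁻¹ := by positivity
  have hr0 : 0 ≤ r := by rw [hr]; nlinarith [mul_nonneg hq hab]
  have hGu : Measurable fun z => G z (u z) := hG.comp (measurable_id.prodMk hu)
  have huD : ∀ x, |u x| ≤ D * √(ρ x) :=
    abs_le_of_fixed_point μ hG hu hρ hA ha hC₀ hK hAρ hlip hG0 huK hfix hb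
  have hGm : ∀ k, Measurable fun p : E × (Index → E) => G p.1 (mlp M G k p.1 p.2) := fun k =>
    hG.comp (measurable_fst.prodMk (measurable_mlp hG k))
  have hMm : ∀ k x, Measurable fun s : Index → E => mlp M G k x s - u x := fun k x =>
    ((measurable_mlp hG k).comp (measurable_const.prodMk measurable_id)).sub_const _
  induction n using Nat.strong_induction_on with
  | _ n ih =>
    intro x
    rcases n with _ | n
    -- At level zero the error is `u` itself, which is why the a priori bound on `u` has to have the
    -- explicit constant `D`.
    · simp only [mlp_zero, pow_zero, mul_one, zero_sub]
      rw [eLpNorm_two_const, abs_neg]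
      exact ENNReal.ofReal_le_ofReal (huD x)
    -- the law of one sample of level `k`
    have hmpb : ∀ (k : ℕ) (m : ℕ), 1 ≤ m →
        MeasurePreserving (branch (E := E) k m) ν (μ.prod (ν.prod ν)) := fun k m hm =>
      ⟨measurable_branch _ _, map_branch μ k (by exact_mod_cast hm)⟩
    -- composition with `G` in the weighted norm
    have hGk : ∀ k < n + 1, ∀ z, eLpNorm (fun s => G z (mlp M G k z s) - G z (u z)) 2 ν
        ≤ ENNReal.ofReal (a * (D * r ^ k) * √(ρ z)) := by
      intro k hk z
      have h1 : eLpNorm (fun s => G z (mlp M G k z s) - G z (u z)) 2 ν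
          ≤ ENNReal.ofReal a * eLpNorm (fun s => mlp M G k z s - u z) 2 ν := by
        refine eLpNorm_le_mul_eLpNorm_of_ae_le_mul (Filter.Eventually.of_forall fun s => ?_) 2
        exact hlip _ _ _
      refine h1.trans ?_
      rw [mul_assoc a, ENNReal.ofReal_mul ha]
      gcongr
      exact ih k hk z
    -- the difference of two consecutive levels
    have hV : ∀ k < n + 1, ∀ z, eLpNorm (fun p : (Index → E) × (Index → E) =>
        G z (mlp M G k z p.1) - G z (mlp M G (k - 1) z p.2)) 2 (ν.prod ν)
        ≤ ENNReal.ofReal (a * (D * r ^ k + D * r ^ (k - 1)) * √(ρ z)) := by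
      intro k hk z
      have hm : ∀ j, Measurable fun s : Index → E => G z (mlp M G j z s) - G z (u z) := fun j =>
        ((hGm j).comp (measurable_const.prodMk measurable_id)).sub_const _
      have h1 := eLpNorm_comp_measurePreserving (p := 2) (hm k).aestronglyMeasurable
        (measurePreserving_fst (μ := ν) (ν := ν))
      have h2 := eLpNorm_comp_measurePreserving (p := 2) (hm (k - 1)).aestronglyMeasurable
        (measurePreserving_snd (μ := ν) (ν := ν))
      have h3 := eLpNorm_sub_le (μ := ν.prod ν) (p := 2)
        ((hm k).comp measurable_fst).aestronglyMeasurable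
        ((hm (k - 1)).comp measurable_snd).aestronglyMeasurable one_le_two
      rw [h1, h2] at h3
      refine le_trans (le_of_eq ?_) (h3.trans (add_le_add (hGk k hk z) (hGk (k - 1) (by omega) z)))
        |>.trans (le_of_eq ?_)
      · congr 1
        funext p
        simp
      · rw [← ENNReal.ofReal_add (by positivity) (by positivity)]
        congr 1
        ring
    have hVm : ∀ k, Measurable fun p : E × (Index → E) × (Index → E) =>
        G p.1 (mlp M G k p.1 p.2.1) - G p.1 (mlp M G (k - 1) p.1 p.2.2) := fun k =>
      ((hGm k).comp (measurable_fst.prodMk (measurable_fst.comp measurable_snd))).sub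
        ((hGm (k - 1)).comp (measurable_fst.prodMk (measurable_snd.comp measurable_snd)))
    have hVx : ∀ k < n + 1, eLpNorm (fun p : E × (Index → E) × (Index → E) =>
        G (x + p.1) (mlp M G k (x + p.1) p.2.1) - G (x + p.1) (mlp M G (k - 1) (x + p.1) p.2.2))
        2 (μ.prod (ν.prod ν))
        ≤ ENNReal.ofReal (√A * (a * (D * r ^ k + D * r ^ (k - 1))) * √(ρ x)) := fun k hk =>
      eLpNorm_two_comp_add_le μ (ν.prod ν) hρ hA hAρ (hVm k) (by positivity) (hV k hk) x
    have hV0 : eLpNorm (fun p : E × (Index → E) × (Index → E) => G (x + p.1) 0)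
        2 (μ.prod (ν.prod ν)) ≤ ENNReal.ofReal (√A * C₀ * √(ρ x)) := by
      refine eLpNorm_two_comp_add_le μ (ν.prod ν) hρ hA hAρ
        (V := fun p : E × (Index → E) × (Index → E) => G p.1 0)
        (hG.comp (measurable_fst.prodMk measurable_const)) hC₀ (fun z => ?_) x
      exact (eLpNorm_two_const (G z 0)).trans_le (ENNReal.ofReal_le_ofReal (hG0 z))
    -- the means of the levels
    set γ : ℕ → ℝ := fun k =>
      ∫ p : E × (Index → E), G (x + p.1) (mlp M G k (x + p.1) p.2) ∂(μ.prod ν) with hγ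
    have hGxm : ∀ k, Measurable fun p : E × (Index → E) =>
        G (x + p.1) (mlp M G k (x + p.1) p.2) := fun k =>
      (hGm k).comp ((measurable_fst.const_add x).prodMk measurable_snd)
    have hGum : Measurable fun p : E × (Index → E) => G (x + p.1) (u (x + p.1)) :=
      hGu.comp (measurable_fst.const_add x)
    have hGkx : ∀ k < n + 1, eLpNorm (fun p : E × (Index → E) =>
        G (x + p.1) (mlp M G k (x + p.1) p.2) - G (x + p.1) (u (x + p.1))) 2 (μ.prod ν)
        ≤ ENNReal.ofReal (√A * (a * (D * r ^ k)) * √(ρ x)) := fun k hk =>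
      eLpNorm_two_comp_add_le μ ν hρ hA hAρ
        (V := fun p : E × (Index → E) => G p.1 (mlp M G k p.1 p.2) - G p.1 (u p.1))
        ((hGm k).sub (hGu.comp measurable_fst)) (by positivity) (hGk k hk) x
    have hGux : eLpNorm (fun p : E × (Index → E) => G (x + p.1) (u (x + p.1))) 2 (μ.prod ν)
        ≤ ENNReal.ofReal (√A * (C₀ + a * D) * √(ρ x)) := by
      refine eLpNorm_two_comp_add_le μ ν hρ hA hAρ
        (V := fun p : E × (Index → E) => G p.1 (u p.1))
        (hGu.comp measurable_fst) (by positivity) (fun z => ?_) x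
      refine (eLpNorm_two_const (G z (u z))).trans_le (ENNReal.ofReal_le_ofReal ?_)
      have h1 := hlip z (u z) 0
      have h2 := hG0 z
      have h3 := mul_le_mul_of_nonneg_left (huD z) ha
      have h4 : |G z (u z)| ≤ |G z (u z) - G z 0| + |G z 0| := by
        simpa using abs_add_le (G z (u z) - G z 0) (G z 0)
      rw [sub_zero] at h1
      nlinarith
    have hintu : Integrable (fun p : E × (Index → E) => G (x + p.1) (u (x + p.1))) (μ.prod ν) :=
      MemLp.integrable one_le_two
        ⟨hGum.aestronglyMeasurable, hGux.trans_lt ENNReal.ofReal_lt_top⟩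
    -- The induction hypothesis controls only the distance to `G(·, u)`, so integrability is
    -- transferred from the latter.
    have hintk : ∀ k < n + 1, Integrable (fun p : E × (Index → E) =>
        G (x + p.1) (mlp M G k (x + p.1) p.2)) (μ.prod ν) := by
      intro k hk
      have : Integrable (fun p : E × (Index → E) =>
          G (x + p.1) (mlp M G k (x + p.1) p.2) - G (x + p.1) (u (x + p.1))) (μ.prod ν) :=
        MemLp.integrable one_le_two
          ⟨((hGxm k).sub hGum).aestronglyMeasurable, (hGkx k hk).trans_lt ENNReal.ofReal_lt_top⟩
      exact (this.add hintu).congr (Filter.Eventually.of_forall fun p => by simp)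
    have hπ₁ : MeasurePreserving (fun p : E × (Index → E) × (Index → E) => (p.1, p.2.1))
        (μ.prod (ν.prod ν)) (μ.prod ν) :=
      (MeasurePreserving.id μ).prod (measurePreserving_fst (μ := ν) (ν := ν))
    have hπ₂ : MeasurePreserving (fun p : E × (Index → E) × (Index → E) => (p.1, p.2.2))
        (μ.prod (ν.prod ν)) (μ.prod ν) :=
      (MeasurePreserving.id μ).prod (measurePreserving_snd (μ := ν) (ν := ν))
    have hmean : ∀ k < n + 1, ∀ m : ℕ, 1 ≤ m →
        ∫ s, (G (x + s (Index.child k m [])) (mlp M G k (x + s (Index.child k m [])) (shift k m s))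
          - G (x + s (Index.child k m []))
            (mlp M G (k - 1) (x + s (Index.child k m [])) (shift k (-m) s))) ∂ν
        = γ k - γ (k - 1) := by
      intro k hk m hm
      have h2 : ∫ p : E × (Index → E) × (Index → E), (G (x + p.1) (mlp M G k (x + p.1) p.2.1)
          - G (x + p.1) (mlp M G (k - 1) (x + p.1) p.2.2)) ∂(μ.prod (ν.prod ν))
          = γ k - γ (k - 1) := by
        rw [integral_sub]
        · congr 1
          · exact integral_comp_measurePreserving hπ₁ (hGxm k)
          · exact integral_comp_measurePreserving hπ₂ (hGxm (k - 1))
        · exact hπ₁.integrable_comp_of_integrable (hintk k hk)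
        · exact hπ₂.integrable_comp_of_integrable (hintk (k - 1) (by omega))
      rw [← h2]
      exact integral_comp_measurePreserving (hmpb k m hm)
        ((hVm k).comp ((measurable_fst.const_add x).prodMk measurable_snd))
    have hmean0 : ∀ m : ℕ, 1 ≤ m → ∫ s, G (x + s (Index.child 0 m [])) 0 ∂ν = γ 0 := by
      intro m hm
      have hm0 : Measurable fun y => G (x + y) 0 :=
        hG.comp ((measurable_const_add x).prodMk measurable_const)
      have h1 : ∫ s, G (x + s (Index.child 0 m [])) 0 ∂ν = ∫ y, G (x + y) 0 ∂μ :=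
        integral_comp_measurePreserving (φ := fun s : Index → E => s (Index.child 0 m []))
          (measurePreserving_eval_infinitePi (fun _ : Index => μ) (Index.child 0 m [])) hm0
      rw [h1, hγ]
      simp only [mlp_zero]
      exact (integral_comp_measurePreserving (measurePreserving_fst (μ := μ) (ν := ν)) hm0).symm
    -- The level means telescope: level `n + 1` of the scheme has expectation `γ n`, exactly one
    -- Picard step applied to level `n`.
    have htel : ∀ j : ℕ, ∑ k ∈ Finset.Ico 1 (j + 1), (γ k - γ (k - 1)) = γ j - γ 0 := by
      intro j
      induction j with
      | zero => simp
      | succ j ihj =>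
        rw [Finset.sum_Ico_succ_top (by omega), ihj, Nat.add_sub_cancel]
        ring
    -- the statistical errors
    have hsqrt : ∀ j : ℕ, (√((M ^ j : ℕ) : ℝ))⁻¹ = (√M)⁻¹ ^ j := by
      intro j
      rw [Nat.cast_pow, inv_pow, Real.sqrt_eq_rpow, Real.sqrt_eq_rpow, ← Real.rpow_natCast,
        ← Real.rpow_natCast, ← Real.rpow_mul (by positivity), ← Real.rpow_mul (by positivity),
        mul_comm]
    have hcard : ∀ j : ℕ, (Finset.Icc 1 (M ^ j)).card = M ^ j := fun j => by simp
    have hne : ∀ j : ℕ, (Finset.Icc 1 (M ^ j)).Nonempty := fun j =>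
      Finset.nonempty_Icc.2 (Nat.one_le_pow _ _ hM)
    have hstat0 : eLpNorm (fun s : Index → E => ((M : ℝ) ^ (n + 1))⁻¹ *
        ∑ m ∈ Finset.Icc 1 (M ^ (n + 1)), G (x + s (Index.child 0 m [])) 0 - γ 0) 2 ν
        ≤ ENNReal.ofReal ((√M)⁻¹ ^ (n + 1) * (√A * C₀ * √(ρ x))) := by
      have hZ : Measurable fun p : E × (Index → E) × (Index → E) => G (x + p.1) 0 :=
        hG.comp ((measurable_fst.const_add x).prodMk measurable_const)
      have := eLpNorm_average_sub_integral_le (P := ν) (Finset.Icc 1 (M ^ (n + 1))) (hne _)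
        (fun m s => G (x + s (Index.child 0 m [])) 0) (B := √A * C₀ * √(ρ x))
        (fun m _ => hZ.comp (measurable_branch 0 m))
        (fun m hm m' hm' hmm => (indepFun_branch μ 0
          (by exact_mod_cast (Finset.mem_Icc.1 hm).1) (by exact_mod_cast (Finset.mem_Icc.1 hm').1)
          (by exact_mod_cast hmm)).comp hZ hZ) (by positivity)
        (fun m hm => by
          have h1 := eLpNorm_comp_measurePreserving (p := 2) hZ.aestronglyMeasurable
            (hmpb 0 m (Finset.mem_Icc.1 hm).1)
          exact (le_of_eq h1).trans hV0)
        (fun m hm => hmean0 m (Finset.mem_Icc.1 hm).1)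
      rw [hcard, hsqrt, Nat.cast_pow] at this
      exact this
    let T : ℕ → (Index → E) → ℝ := fun k s =>
        ((M : ℝ) ^ (n + 1 - k))⁻¹ * ∑ m ∈ Finset.Icc 1 (M ^ (n + 1 - k)),
          (G (x + s (Index.child k m [])) (mlp M G k (x + s (Index.child k m [])) (shift k m s))
          - G (x + s (Index.child k m []))
            (mlp M G (k - 1) (x + s (Index.child k m [])) (shift k (-m) s)))
          - (γ k - γ (k - 1))
    have hstat : ∀ k ∈ Finset.Ico 1 (n + 1), eLpNorm (T k) 2 ν
        ≤ ENNReal.ofReal ((√M)⁻¹ ^ (n + 1 - k) *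
            (√A * (a * (D * r ^ k + D * r ^ (k - 1))) * √(ρ x))) := by
      intro k hk
      have hk' := Finset.mem_Ico.1 hk
      have hZ : Measurable fun p : E × (Index → E) × (Index → E) =>
          G (x + p.1) (mlp M G k (x + p.1) p.2.1)
            - G (x + p.1) (mlp M G (k - 1) (x + p.1) p.2.2) :=
        (hVm k).comp ((measurable_fst.const_add x).prodMk measurable_snd)
      have := eLpNorm_average_sub_integral_le (P := ν) (Finset.Icc 1 (M ^ (n + 1 - k))) (hne _)
        (fun m s => G (x + s (Index.child k m []))
            (mlp M G k (x + s (Index.child k m [])) (shift k m s))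
          - G (x + s (Index.child k m []))
            (mlp M G (k - 1) (x + s (Index.child k m [])) (shift k (-m) s)))
        (B := √A * (a * (D * r ^ k + D * r ^ (k - 1))) * √(ρ x))
        (fun m _ => hZ.comp (measurable_branch k m))
        (fun m hm m' hm' hmm => (indepFun_branch μ k
          (by exact_mod_cast (Finset.mem_Icc.1 hm).1) (by exact_mod_cast (Finset.mem_Icc.1 hm').1)
          (by exact_mod_cast hmm)).comp hZ hZ) (by positivity)
        (fun m hm => by
          have h1 := eLpNorm_comp_measurePreserving (p := 2) hZ.aestronglyMeasurable
            (hmpb k m (Finset.mem_Icc.1 hm).1)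
          exact (le_of_eq h1).trans (hVx k hk'.2))
        (fun m hm => hmean k hk'.2 m (Finset.mem_Icc.1 hm).1)
      rw [hcard, hsqrt, Nat.cast_pow] at this
      exact this
    -- the bias
    have hbias : |γ n - u x| ≤ √A * (a * (D * r ^ n)) * √(ρ x) := by
      have h1 : u x = ∫ p : E × (Index → E), G (x + p.1) (u (x + p.1)) ∂(μ.prod ν) := by
        rw [hfix x]
        exact (integral_comp_measurePreserving (measurePreserving_fst (μ := μ) (ν := ν))
          (hGu.comp (measurable_const_add x))).symm
      rw [h1, hγ, ← integral_sub (hintk n (by omega)) hintu]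
      exact abs_integral_le_of_eLpNorm_two_le (by positivity)
        ((hGxm n).sub hGum).aestronglyMeasurable (hGkx n (by omega))
    -- Centred level-zero average, plus centred level differences, plus bias; the triangle
    -- inequality then reproduces the three terms of the recursion.
    have hdecomp : (fun s => mlp M G (n + 1) x s - u x) =
        (fun s : Index → E => ((M : ℝ) ^ (n + 1))⁻¹ *
          ∑ m ∈ Finset.Icc 1 (M ^ (n + 1)), G (x + s (Index.child 0 m [])) 0 - γ 0)
        + (∑ k ∈ Finset.Ico 1 (n + 1), T k)
        + fun _ => γ n - u x := by
      funext s
      rw [mlp_of_pos (by omega)]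
      simp only [Pi.add_apply, Finset.sum_apply, T]
      rw [Finset.sum_sub_distrib, htel]
      ring
    have hm0 : Measurable fun s : Index → E => ((M : ℝ) ^ (n + 1))⁻¹ *
          ∑ m ∈ Finset.Icc 1 (M ^ (n + 1)), G (x + s (Index.child 0 m [])) 0 - γ 0 := by
      refine (Measurable.const_mul (Finset.measurable_sum _ fun m _ => ?_) _).sub_const _
      have hZ : Measurable fun y => G (x + y) 0 :=
        hG.comp ((measurable_const_add x).prodMk measurable_const)
      exact hZ.comp (measurable_pi_apply (Index.child 0 m []))
    have hmk : ∀ k ∈ Finset.Ico 1 (n + 1), Measurable (T k) := by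
      intro k _
      refine (Measurable.const_mul (Finset.measurable_sum _ fun m _ => ?_) _).sub_const _
      exact ((hVm k).comp ((measurable_fst.const_add x).prodMk measurable_snd)).comp
        (measurable_branch k m)
    have hmks : Measurable (∑ k ∈ Finset.Ico 1 (n + 1), T k) := by
      convert! Finset.measurable_sum _ hmk
      rw [Finset.sum_apply]
    rw [hdecomp]
    refine (eLpNorm_add_le (hm0.add hmks).aestronglyMeasurable
      aestronglyMeasurable_const one_le_two).trans ?_
    refine (add_le_add ((eLpNorm_add_le hm0.aestronglyMeasurable
      hmks.aestronglyMeasurable one_le_two).trans (add_le_add hstat0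
        ((eLpNorm_sum_le (fun k hk => (hmk k hk).aestronglyMeasurable) one_le_two).trans
          (Finset.sum_le_sum hstat)))) (eLpNorm_two_const _).le).trans ?_
    rw [← ENNReal.ofReal_sum_of_nonneg (fun k _ => by positivity),
      ← ENNReal.ofReal_add (by positivity) (Finset.sum_nonneg fun k _ => by positivity),
      ← ENNReal.ofReal_add (add_nonneg (by positivity) (Finset.sum_nonneg fun k _ => by positivity))
        (abs_nonneg _)]
    refine ENNReal.ofReal_le_ofReal ?_
    have hKD : C₀ * √A ≤ D := by
      rw [hD, le_div_iff₀ h1b]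
      nlinarith [mul_nonneg (mul_nonneg hC₀ (Real.sqrt_nonneg A)) hab]
    have hrec := mul_le_mul_of_nonneg_right
      (error_recursion_geometric_le hab hq hKD hD0 n) (Real.sqrt_nonneg (ρ x))
    rw [← hr] at hrec
    refine le_trans (add_le_add_right hbias _) (le_trans (le_of_eq ?_) hrec)
    rw [add_mul, add_mul, Finset.sum_mul]
    congr 1
    · congr 1
      · ring
      · exact Finset.sum_congr rfl fun k _ => by ring
    · ring

end error

end EllipticMLP

namespace EllipticMLP

/-! ### Green's identity against the heat kernel -/

/-- Half of the Gaussian exponent is spent: a quarter absorbs `1 + r ^ 2` and a quarter absorbs `exp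
(ε r)`, the latter by completing the square. -/
lemma one_add_sq_mul_exp_le {b ε : ℝ} (hb : 0 < b) (r : ℝ) :
    (1 + r ^ 2) * Real.exp (ε * r) * Real.exp (-b * r ^ 2)
      ≤ (1 + 4 / b) * Real.exp (ε ^ 2 / b) * Real.exp (-(b / 2) * r ^ 2) := by
  have h1 : 1 + r ^ 2 ≤ (1 + 4 / b) * Real.exp (b / 4 * r ^ 2) := by
    have h2 := Real.add_one_le_exp (b / 4 * r ^ 2)
    have h3 : (1 + 4 / b) * (b / 4 * r ^ 2 + 1) ≤ (1 + 4 / b) * Real.exp (b / 4 * r ^ 2) := by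
      gcongr
    have h4 : (1 + 4 / b) * (b / 4 * r ^ 2 + 1) = 1 + r ^ 2 + (b / 4 * r ^ 2 + 4 / b) := by
      field_simp
      ring
    have : 0 ≤ b / 4 * r ^ 2 + 4 / b := by positivity
    linarith
  have h2 : Real.exp (ε * r) ≤ Real.exp (ε ^ 2 / b) * Real.exp (b / 4 * r ^ 2) := by
    rw [← Real.exp_add]
    refine Real.exp_le_exp.2 ?_
    have : ε ^ 2 / b + b / 4 * r ^ 2 - ε * r = (ε - b / 2 * r) ^ 2 / b := by
      field_simp
      ring
    have : 0 ≤ (ε - b / 2 * r) ^ 2 / b := by positivity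
    linarith
  calc (1 + r ^ 2) * Real.exp (ε * r) * Real.exp (-b * r ^ 2)
      ≤ ((1 + 4 / b) * Real.exp (b / 4 * r ^ 2)) *
        (Real.exp (ε ^ 2 / b) * Real.exp (b / 4 * r ^ 2)) * Real.exp (-b * r ^ 2) := by gcongr
    _ = (1 + 4 / b) * Real.exp (ε ^ 2 / b) *
        (Real.exp (b / 4 * r ^ 2) * Real.exp (b / 4 * r ^ 2) * Real.exp (-b * r ^ 2)) := by ring
    _ = _ := by
        rw [← Real.exp_add, ← Real.exp_add]
        ring_nf

section heat

variable {d : ℕ}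

lemma integrable_exp_neg_mul_norm_sq {b : ℝ} (hb : 0 < b) :
    Integrable fun z : EuclideanSpace ℝ (Fin d) => Real.exp (-b * ‖z‖ ^ 2) := by
  have h := GaussianFourier.integrable_cexp_neg_mul_sq_norm_add (b := (b : ℂ)) (by simpa using hb)
    0 (0 : EuclideanSpace ℝ (Fin d))
  refine h.norm.congr (Filter.Eventually.of_forall fun z => ?_)
  simp only [zero_mul, add_zero]
  rw [← Complex.ofReal_pow, ← Complex.ofReal_neg, ← Complex.ofReal_mul, ← Complex.ofReal_exp,
    Complex.norm_real, Real.norm_of_nonneg (Real.exp_pos _).le]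

lemma integrable_one_add_sq_mul_exp {b : ℝ} (hb : 0 < b) (ε : ℝ) :
    Integrable fun z : EuclideanSpace ℝ (Fin d) =>
      (1 + ‖z‖ ^ 2) * Real.exp (ε * ‖z‖) * Real.exp (-b * ‖z‖ ^ 2) := by
  refine Integrable.mono' ((integrable_exp_neg_mul_norm_sq (d := d) (half_pos hb)).const_mul
    ((1 + 4 / b) * Real.exp (ε ^ 2 / b))) (by fun_prop)
    (Filter.Eventually.of_forall fun z => ?_)
  rw [Real.norm_of_nonneg (by positivity)]
  exact one_add_sq_mul_exp_le hb ‖z‖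

/-- Green's second identity with a compactly supported test function. -/
lemma integral_mul_eq_integral_laplacian_mul {v : EuclideanSpace ℝ (Fin d) → ℝ}
    (hv : ContDiff ℝ 2 v) {q : EuclideanSpace ℝ (Fin d) → ℝ}
    {q₁ q₂ : Fin d → EuclideanSpace ℝ (Fin d) → ℝ} (hq : Continuous q)
    (hqc : HasCompactSupport q) (hq₁ : ∀ j, Continuous (q₁ j)) (hq₁c : ∀ j, HasCompactSupport (q₁ j))
    (hq₂ : ∀ j, Continuous (q₂ j)) (hq₂c : ∀ j, HasCompactSupport (q₂ j))
    (h₁ : ∀ j z, HasLineDerivAt ℝ q (q₁ j z) z (EuclideanSpace.basisFun (Fin d) ℝ j))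
    (h₂ : ∀ j z, HasLineDerivAt ℝ (q₁ j) (q₂ j z) z (EuclideanSpace.basisFun (Fin d) ℝ j)) :
    ∫ z, v z * ∑ j, q₂ j z = ∫ z, Laplacian.laplacian v z * q z := by
  set e := EuclideanSpace.basisFun (Fin d) ℝ with he
  have hv1 : ContDiff ℝ 1 (fderiv ℝ v) := hv.fderiv_right (by norm_num)
  have hv2 : Continuous (fderiv ℝ (fderiv ℝ v)) := hv1.continuous_fderiv (by norm_num)
  have hc1 : ∀ j, Continuous fun z => fderiv ℝ v z (e j) := fun j =>
    hv1.continuous.clm_apply continuous_const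
  have hc2 : ∀ j, Continuous fun z => fderiv ℝ (fderiv ℝ v) z (e j) (e j) := fun j =>
    (hv2.clm_apply continuous_const).clm_apply continuous_const
  have hl1 : ∀ j z, HasLineDerivAt ℝ v (fderiv ℝ v z (e j)) z (e j) := fun j z =>
    ((hv.differentiable (by norm_num)) z).hasFDerivAt.hasLineDerivAt _
  have hl2 : ∀ j z, HasLineDerivAt ℝ (fun z => fderiv ℝ v z (e j))
      (fderiv ℝ (fderiv ℝ v) z (e j) (e j)) z (e j) := by
    intro j z
    have h := ((hv1.differentiable (by norm_num)) z).hasFDerivAt.clm_apply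
      (hasFDerivAt_const (e j) z)
    simpa using h.hasLineDerivAt (e j)
  have hint : ∀ {f g : EuclideanSpace ℝ (Fin d) → ℝ}, Continuous f → Continuous g →
      HasCompactSupport g → Integrable fun z => f z * g z := fun hf hg hgc =>
    (hf.mul hg).integrable_of_hasCompactSupport hgc.mul_left
  -- Two integrations by parts in direction `j`. Compact support supplies integrability of the
  -- intermediate product with the first derivative of `v`, whose growth is not controlled.
  have hibp : ∀ j, ∫ z, v z * q₂ j z = ∫ z, fderiv ℝ (fderiv ℝ v) z (e j) (e j) * q z := by
    intro j
    have i1 := integral_bilinear_hasLineDerivAt_right_eq_neg_left_of_integrable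
      (μ := (volume : Measure (EuclideanSpace ℝ (Fin d)))) (B := ContinuousLinearMap.mul ℝ ℝ)
      (f := v) (f' := fun z => fderiv ℝ v z (e j)) (g := q₁ j) (g' := q₂ j) (v := e j)
      (hint (hc1 j) (hq₁ j) (hq₁c j)) (hint hv.continuous (hq₂ j) (hq₂c j))
      (hint hv.continuous (hq₁ j) (hq₁c j)) (fun z _ => hl1 j z) (fun z _ => h₂ j z)
    have i2 := integral_bilinear_hasLineDerivAt_right_eq_neg_left_of_integrable
      (μ := (volume : Measure (EuclideanSpace ℝ (Fin d)))) (B := ContinuousLinearMap.mul ℝ ℝ)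
      (f := fun z => fderiv ℝ v z (e j)) (f' := fun z => fderiv ℝ (fderiv ℝ v) z (e j) (e j))
      (g := q) (g' := q₁ j) (v := e j)
      (hint (hc2 j) hq hqc) (hint (hc1 j) (hq₁ j) (hq₁c j))
      (hint (hc1 j) hq hqc) (fun z _ => hl2 j z) (fun z _ => h₁ j z)
    simp only [ContinuousLinearMap.mul_apply'] at i1 i2
    rw [i1, i2, neg_neg]
  rw [InnerProductSpace.laplacian_eq_iteratedFDeriv_orthonormalBasis v e]
  simp only [Finset.mul_sum, Finset.sum_mul]
  rw [integral_finsetSum _ fun j _ => hint hv.continuous (hq₂ j) (hq₂c j),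
    integral_finsetSum _ fun j _ => ?_]
  · refine Finset.sum_congr rfl fun j _ => ?_
    simp only [iteratedFDeriv_two_apply]
    exact hibp j
  · simp only [iteratedFDeriv_two_apply]
    exact hint (hc2 j) hq hqc

/-- Compactly supported polynomial approximation of `exp (-s)`. -/
noncomputable def truncExp (N : ℕ) (k : ℕ) (s : ℝ) : ℝ := max 0 (1 - s / N) ^ k

/-- An exponent of at least two flattens the kink of the positive part at `0`. -/
lemma hasDerivAt_max_zero_pow (k : ℕ) (y : ℝ) :
    HasDerivAt (fun y : ℝ => max 0 y ^ (k + 2)) ((k + 2) * max 0 y ^ (k + 1)) y := by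
  rcases lt_trichotomy y 0 with h | rfl | h
  · have : (fun y : ℝ => max 0 y ^ (k + 2)) =ᶠ[nhds y] fun _ => 0 := by
      filter_upwards [Iio_mem_nhds h] with z hz
      simp [max_eq_left (Set.mem_Iio.1 hz).le]
    rw [max_eq_left h.le]
    simpa using (hasDerivAt_const y (0 : ℝ)).congr_of_eventuallyEq this
  · have h0 : ((k : ℝ) + 2) * max 0 (0 : ℝ) ^ (k + 1) = 0 := by simp
    rw [h0, hasDerivAt_iff_isLittleO]
    simp only [max_self, ne_eq, Nat.add_eq_zero_iff, OfNat.ofNat_ne_zero, and_false,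
      not_false_eq_true, zero_pow, sub_zero, smul_eq_mul, mul_zero]
    have h1 : (fun y : ℝ => max 0 y ^ (k + 2)) =O[nhds 0] fun y => y ^ (k + 2) := by
      refine Asymptotics.isBigO_of_le _ fun z => ?_
      rw [norm_pow, norm_pow]
      gcongr
      rw [Real.norm_eq_abs, Real.norm_eq_abs, abs_of_nonneg (le_max_left _ _)]
      exact max_le (abs_nonneg _) (le_abs_self _)
    refine h1.trans_isLittleO ?_
    simpa using Asymptotics.isLittleO_pow_id (𝕜 := ℝ) (n := k + 2) (by omega)
  · have : (fun y : ℝ => max 0 y ^ (k + 2)) =ᶠ[nhds y] fun y => y ^ (k + 2) := by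
      filter_upwards [Ioi_mem_nhds h] with z hz
      rw [max_eq_right (Set.mem_Ioi.1 hz).le]
    rw [max_eq_right h.le]
    have h1 := (hasDerivAt_pow (k + 2) y).congr_of_eventuallyEq this
    simpa using h1

lemma hasDerivAt_truncExp (N k : ℕ) (s : ℝ) :
    HasDerivAt (truncExp N (k + 2)) (-((k + 2) / N * truncExp N (k + 1) s)) s := by
  have h1 : HasDerivAt (fun s : ℝ => 1 - s / N) (-(1 / N)) s := by
    simpa using ((hasDerivAt_id s).div_const (N : ℝ)).const_sub 1
  have h2 := (hasDerivAt_max_zero_pow k (1 - s / N)).comp s h1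
  unfold truncExp
  refine h2.congr_deriv ?_
  ring

lemma continuous_truncExp (N k : ℕ) : Continuous (truncExp N k) := by
  unfold truncExp
  fun_prop

lemma truncExp_nonneg (N k : ℕ) (s : ℝ) : 0 ≤ truncExp N k s :=
  pow_nonneg (le_max_left _ _) _

/-- From `1 - s / N ≤ exp (-(s / N))`. This gives a Gaussian majorant uniform in the truncation once
the exponent `k` is at least a fixed fraction of `N`. -/
lemma truncExp_le {N k : ℕ} {s c : ℝ} (hs : 0 ≤ s) (hN : 0 < N) (hk : c * N ≤ k) :
    truncExp N k s ≤ Real.exp (-(c * s)) := by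
  have hN' : (0 : ℝ) < N := by exact_mod_cast hN
  have h1 : max 0 (1 - s / N) ≤ Real.exp (-(s / N)) :=
    max_le (Real.exp_pos _).le (by linarith [Real.add_one_le_exp (-(s / N))])
  calc truncExp N k s ≤ Real.exp (-(s / N)) ^ k := by
        unfold truncExp
        gcongr
    _ = Real.exp (-(k * (s / N))) := by rw [← Real.exp_nat_mul, mul_neg]
    _ ≤ Real.exp (-(c * s)) := by
        refine Real.exp_le_exp.2 (neg_le_neg ?_)
        have h2 : c * s = c * N * (s / N) := by field_simp
        rw [h2]
        exact mul_le_mul_of_nonneg_right hk (by positivity)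

/-- Euler's limit; lowering the exponent by a fixed `j` divides by `(1 - s / n) ^ j`, which tends to
`1`. The offset `4` keeps positive the exponents that remain after two differentiations. -/
lemma tendsto_truncExp (j : ℕ) (s : ℝ) :
    Filter.Tendsto (fun n : ℕ => truncExp (n + 4) (n + 4 - j) s) Filter.atTop
      (nhds (Real.exp (-s))) := by
  have h0 : Filter.Tendsto (fun n : ℕ => 1 - s / ((n : ℕ) : ℝ)) Filter.atTop (nhds 1) := by
    simpa using (tendsto_const_div_atTop_nhds_zero_nat s).const_sub 1
  have h1 : Filter.Tendsto (fun n : ℕ => truncExp n (n - j) s) Filter.atTop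
      (nhds (Real.exp (-s))) := by
    have h2 := Real.tendsto_one_add_div_pow_exp (-s)
    have h3 : Filter.Tendsto (fun n : ℕ => (1 - s / ((n : ℕ) : ℝ)) ^ j) Filter.atTop
        (nhds 1) := by simpa using h0.pow j
    have h4 := h2.div h3 one_ne_zero
    rw [div_one] at h4
    refine h4.congr' ?_
    filter_upwards [h0.eventually (lt_mem_nhds zero_lt_one), Filter.eventually_ge_atTop j]
      with n hn hj
    unfold truncExp
    rw [max_eq_right hn.le, pow_sub₀ _ hn.ne' hj]
    simp only [Pi.div_apply]
    rw [neg_div, ← sub_eq_add_neg, div_eq_mul_inv]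
  exact h1.comp (Filter.tendsto_add_atTop_nat 4)

lemma hasLineDerivAt_norm_sq (z : EuclideanSpace ℝ (Fin d)) (j : Fin d) :
    HasLineDerivAt ℝ (fun z : EuclideanSpace ℝ (Fin d) => ‖z‖ ^ 2) (2 * z j) z
      (EuclideanSpace.basisFun (Fin d) ℝ j) := by
  have h := (hasStrictFDerivAt_norm_sq z).hasFDerivAt.hasLineDerivAt
    (EuclideanSpace.basisFun (Fin d) ℝ j)
  refine h.congr_deriv ?_
  simp [EuclideanSpace.inner_single_right]

lemma hasLineDerivAt_coord (z : EuclideanSpace ℝ (Fin d)) (j : Fin d) :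
    HasLineDerivAt ℝ (fun z : EuclideanSpace ℝ (Fin d) => z j) 1 z
      (EuclideanSpace.basisFun (Fin d) ℝ j) := by
  have h := (EuclideanSpace.proj (𝕜 := ℝ) (ι := Fin d) j).hasFDerivAt (x := z) |>.hasLineDerivAt
    (EuclideanSpace.basisFun (Fin d) ℝ j)
  simpa using h

lemma hasLineDerivAt_truncExp (N k : ℕ) {τ : ℝ} (z : EuclideanSpace ℝ (Fin d)) (j : Fin d) :
    HasLineDerivAt ℝ (fun z : EuclideanSpace ℝ (Fin d) => truncExp N (k + 2) (‖z‖ ^ 2 / τ))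
      (-((k + 2) / N * truncExp N (k + 1) (‖z‖ ^ 2 / τ)) * (2 * z j / τ)) z
      (EuclideanSpace.basisFun (Fin d) ℝ j) := by
  have h1 : HasDerivAt (fun t : ℝ => ‖z + t • EuclideanSpace.basisFun (Fin d) ℝ j‖ ^ 2 / τ)
      (2 * z j / τ) 0 := (hasLineDerivAt_norm_sq z j).div_const τ
  have h2 : HasDerivAt (truncExp N (k + 2)) (-((k + 2) / N * truncExp N (k + 1) (‖z‖ ^ 2 / τ)))
      (‖z + (0 : ℝ) • EuclideanSpace.basisFun (Fin d) ℝ j‖ ^ 2 / τ) := by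
    simpa using hasDerivAt_truncExp N k (‖z‖ ^ 2 / τ)
  exact h2.comp (0 : ℝ) h1

lemma hasCompactSupport_truncExp {N k : ℕ} (hN : 0 < N) (hk : k ≠ 0) {τ : ℝ} (hτ : 0 < τ) :
    HasCompactSupport fun z : EuclideanSpace ℝ (Fin d) => truncExp N k (‖z‖ ^ 2 / τ) := by
  refine HasCompactSupport.intro (isCompact_closedBall (0 : EuclideanSpace ℝ (Fin d)) √(N * τ))
    fun z hz => ?_
  have hN' : (0 : ℝ) < N := by exact_mod_cast hN
  simp only [Metric.mem_closedBall, dist_zero_right, not_le] at hz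
  have h1 : N * τ ≤ ‖z‖ ^ 2 := (Real.sqrt_le_left (norm_nonneg z)).1 hz.le
  unfold truncExp
  rw [max_eq_left, zero_pow hk]
  rw [sub_nonpos, le_div_iff₀ hN', le_div_iff₀ hτ]
  linarith

lemma hasLineDerivAt_truncExp_mul (N k : ℕ) {τ : ℝ} (z : EuclideanSpace ℝ (Fin d)) (j : Fin d) :
    HasLineDerivAt ℝ (fun z : EuclideanSpace ℝ (Fin d) =>
        truncExp N (k + 2) (‖z‖ ^ 2 / τ) * (-(2 * z j / τ)))
      ((k + 2) / N * truncExp N (k + 1) (‖z‖ ^ 2 / τ) * (2 * z j / τ) ^ 2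
        - truncExp N (k + 2) (‖z‖ ^ 2 / τ) * (2 / τ)) z
      (EuclideanSpace.basisFun (Fin d) ℝ j) := by
  have h1 : HasDerivAt (fun t : ℝ =>
      truncExp N (k + 2) (‖z + t • EuclideanSpace.basisFun (Fin d) ℝ j‖ ^ 2 / τ))
      (-((k + 2) / N * truncExp N (k + 1) (‖z‖ ^ 2 / τ)) * (2 * z j / τ)) 0 :=
    hasLineDerivAt_truncExp N k (τ := τ) z j
  have h2 : HasDerivAt (fun t : ℝ =>
      -(2 * (z + t • EuclideanSpace.basisFun (Fin d) ℝ j) j / τ)) (-(2 * 1 / τ)) 0 :=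
    (((hasLineDerivAt_coord z j).const_mul 2).div_const τ).neg
  have h3 := h1.mul h2
  rw [zero_smul, add_zero] at h3
  exact h3.congr_deriv (by ring)

/-- Green's identity for the truncated kernel. Differentiating `truncExp N k` gives a factor `k /
N`, which is `1` for the first derivative and `(n + 3) / (n + 4)` for the second. Letting `n → ∞`
uses bounds on `v` and `Δv` only, none on the gradient. -/
lemma integral_mul_truncExp_eq {v : EuclideanSpace ℝ (Fin d) → ℝ} (hv : ContDiff ℝ 2 v) {τ : ℝ}
    (hτ : 0 < τ) (n : ℕ) :
    ∫ z, v z * ((4 * ‖z‖ ^ 2 / τ ^ 2) * ((n + 3) / (n + 4)) * truncExp (n + 4) (n + 2) (‖z‖ ^ 2 / τ)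
      - 2 * d / τ * truncExp (n + 4) (n + 3) (‖z‖ ^ 2 / τ))
    = ∫ z, Laplacian.laplacian v z * truncExp (n + 4) (n + 4) (‖z‖ ^ 2 / τ) := by
  have hcs : ∀ k, k ≠ 0 → HasCompactSupport fun z : EuclideanSpace ℝ (Fin d) =>
      truncExp (n + 4) k (‖z‖ ^ 2 / τ) := fun k hk =>
    hasCompactSupport_truncExp (by omega) hk hτ
  have hct : ∀ k, Continuous fun z : EuclideanSpace ℝ (Fin d) =>
      truncExp (n + 4) k (‖z‖ ^ 2 / τ) := fun k =>
    (continuous_truncExp (n + 4) k).comp (by fun_prop)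
  have hn : (n : ℝ) + 4 ≠ 0 := by positivity
  have h1 : ∀ (j : Fin d) (z : EuclideanSpace ℝ (Fin d)), HasLineDerivAt ℝ
      (fun z : EuclideanSpace ℝ (Fin d) => truncExp (n + 4) (n + 4) (‖z‖ ^ 2 / τ))
      (truncExp (n + 4) (n + 3) (‖z‖ ^ 2 / τ) * (-(2 * z j / τ))) z
      (EuclideanSpace.basisFun (Fin d) ℝ j) := by
    intro j z
    refine (hasLineDerivAt_truncExp (n + 4) (n + 2) z j).congr_deriv ?_
    rw [show n + 2 + 1 = n + 3 from rfl]
    push_cast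
    field_simp
    ring
  have h2 : ∀ (j : Fin d) (z : EuclideanSpace ℝ (Fin d)), HasLineDerivAt ℝ
      (fun z : EuclideanSpace ℝ (Fin d) =>
        truncExp (n + 4) (n + 3) (‖z‖ ^ 2 / τ) * (-(2 * z j / τ)))
      ((truncExp (n + 4) (n + 2) (‖z‖ ^ 2 / τ) * ((n + 3) / (n + 4)) *
          (2 * z j / τ) ^ 2) - truncExp (n + 4) (n + 3) (‖z‖ ^ 2 / τ) * (2 / τ)) z
      (EuclideanSpace.basisFun (Fin d) ℝ j) := by
    intro j z
    refine (hasLineDerivAt_truncExp_mul (n + 4) (n + 1) z j).congr_deriv ?_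
    rw [show n + 1 + 1 = n + 2 from rfl, show n + 1 + 2 = n + 3 from rfl]
    push_cast
    ring
  have hc2 : ∀ j : Fin d, Continuous fun z : EuclideanSpace ℝ (Fin d) =>
      (truncExp (n + 4) (n + 2) (‖z‖ ^ 2 / τ) * ((n + 3) / (n + 4)) *
          (2 * z j / τ) ^ 2) - truncExp (n + 4) (n + 3) (‖z‖ ^ 2 / τ) * (2 / τ) := fun j =>
    (((hct _).mul continuous_const).mul (by fun_prop)).sub ((hct _).mul continuous_const)
  have hs2 : ∀ j : Fin d, HasCompactSupport fun z : EuclideanSpace ℝ (Fin d) =>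
      (truncExp (n + 4) (n + 2) (‖z‖ ^ 2 / τ) * ((n + 3) / (n + 4)) *
          (2 * z j / τ) ^ 2) - truncExp (n + 4) (n + 3) (‖z‖ ^ 2 / τ) * (2 / τ) := fun j =>
    ((hcs (n + 2) (by omega)).mul_right.mul_right).sub (hcs (n + 3) (by omega)).mul_right
  rw [← integral_mul_eq_integral_laplacian_mul hv (hct (n + 4)) (hcs (n + 4) (by omega))
    (fun j => (hct (n + 3)).mul (by fun_prop)) (fun j => (hcs (n + 3) (by omega)).mul_right)
    hc2 hs2 h1 h2]
  refine integral_congr_ae (Filter.Eventually.of_forall fun z => ?_)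
  simp only
  congr 1
  rw [Finset.sum_sub_distrib, Finset.sum_const, Finset.card_univ, Fintype.card_fin,
    EuclideanSpace.real_norm_sq_eq, nsmul_eq_mul, ← Finset.mul_sum]
  simp only [div_pow, mul_pow]
  rw [← Finset.sum_div, ← Finset.mul_sum]
  ring

/-- Green's identity against the (unnormalized) heat kernel. -/
lemma integral_mul_heat_eq {v : EuclideanSpace ℝ (Fin d) → ℝ} (hv : ContDiff ℝ 2 v) {K ε : ℝ}
    (hvK : ∀ z, |v z| ≤ K * Real.exp (ε * ‖z‖))
    (hLK : ∀ z, |Laplacian.laplacian v z| ≤ K * Real.exp (ε * ‖z‖)) {τ : ℝ} (hτ : 0 < τ) :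
    ∫ z, v z * ((4 * ‖z‖ ^ 2 / τ ^ 2 - 2 * d / τ) * Real.exp (-(‖z‖ ^ 2 / τ)))
      = ∫ z, Laplacian.laplacian v z * Real.exp (-(‖z‖ ^ 2 / τ)) := by
  have hLc : Continuous (Laplacian.laplacian v) := by
    rw [InnerProductSpace.laplacian_eq_iteratedFDeriv_orthonormalBasis v
      (EuclideanSpace.basisFun (Fin d) ℝ)]
    have := hv.continuous_iteratedFDeriv (m := 2) le_rfl
    fun_prop
  have hgreen := integral_mul_truncExp_eq hv hτ
  -- The fraction `1 / 2` works because `n + 2 ≥ (n + 4) / 2`.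
  have hbd : ∀ (n k : ℕ), n + 2 ≤ k → ∀ z : EuclideanSpace ℝ (Fin d),
      truncExp (n + 4) k (‖z‖ ^ 2 / τ) ≤ Real.exp (-(1 / (2 * τ)) * ‖z‖ ^ 2) := by
    intro n k hk z
    refine (truncExp_le (c := 1 / 2) (by positivity) (by omega) ?_).trans (le_of_eq ?_)
    · have : ((n + 2 : ℕ) : ℝ) ≤ k := by exact_mod_cast hk
      push_cast at this ⊢
      linarith
    · congr 1
      field_simp
  have hint := integrable_one_add_sq_mul_exp (d := d) (b := 1 / (2 * τ)) (by positivity) ε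
  have hK : 0 ≤ K := by
    have := (abs_nonneg _).trans (hvK 0)
    simpa using this
  have hl : Filter.Tendsto (fun n : ℕ => ∫ z, v z * ((4 * ‖z‖ ^ 2 / τ ^ 2) * ((n + 3) / (n + 4)) *
      truncExp (n + 4) (n + 2) (‖z‖ ^ 2 / τ) - 2 * d / τ * truncExp (n + 4) (n + 3) (‖z‖ ^ 2 / τ)))
      Filter.atTop (nhds (∫ z, v z * ((4 * ‖z‖ ^ 2 / τ ^ 2 - 2 * d / τ) *
        Real.exp (-(‖z‖ ^ 2 / τ))))) := by
    refine tendsto_integral_of_dominated_convergence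
      (fun z => (K * (4 / τ ^ 2 + 2 * d / τ)) *
        ((1 + ‖z‖ ^ 2) * Real.exp (ε * ‖z‖) * Real.exp (-(1 / (2 * τ)) * ‖z‖ ^ 2)))
      (fun n => ?_) (hint.const_mul _) (fun n => Filter.Eventually.of_forall fun z => ?_)
      (Filter.Eventually.of_forall fun z => ?_)
    · have h1 := hv.continuous
      have h2 := continuous_truncExp (n + 4) (n + 2)
      have h3 := continuous_truncExp (n + 4) (n + 3)
      exact Continuous.aestronglyMeasurable (by fun_prop)
    · rw [norm_mul]
      have h1 := hbd n (n + 2) le_rfl z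
      have h2 := hbd n (n + 3) (by omega) z
      have h3 := truncExp_nonneg (n + 4) (n + 2) (‖z‖ ^ 2 / τ)
      have h4 := truncExp_nonneg (n + 4) (n + 3) (‖z‖ ^ 2 / τ)
      have h5 : ((n : ℝ) + 3) / (n + 4) ≤ 1 := by
        rw [div_le_one (by positivity)]; linarith
      set X := Real.exp (-(1 / (2 * τ)) * ‖z‖ ^ 2)
      have h6 : ‖4 * ‖z‖ ^ 2 / τ ^ 2 * (((n : ℝ) + 3) / (n + 4)) *
          truncExp (n + 4) (n + 2) (‖z‖ ^ 2 / τ) -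
          2 * d / τ * truncExp (n + 4) (n + 3) (‖z‖ ^ 2 / τ)‖
          ≤ (4 / τ ^ 2 + 2 * d / τ) * ((1 + ‖z‖ ^ 2) * X) := by
        refine (norm_sub_le _ _).trans ?_
        rw [Real.norm_of_nonneg (by positivity), Real.norm_of_nonneg (by positivity)]
        calc _ ≤ 4 * ‖z‖ ^ 2 / τ ^ 2 * 1 * X + 2 * d / τ * X := by gcongr
          _ ≤ 4 * ‖z‖ ^ 2 / τ ^ 2 * 1 * X + 2 * d / τ * X
              + (4 / τ ^ 2 * X + 2 * d / τ * ‖z‖ ^ 2 * X) :=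
            le_add_of_nonneg_right (by positivity)
          _ = _ := by ring
      calc ‖v z‖ * _ ≤ (K * Real.exp (ε * ‖z‖)) *
            ((4 / τ ^ 2 + 2 * d / τ) * ((1 + ‖z‖ ^ 2) * X)) := by
            gcongr
            exact hvK z
        _ = _ := by ring
    · have h1 := tendsto_truncExp 2 (‖z‖ ^ 2 / τ)
      have h2 := tendsto_truncExp 1 (‖z‖ ^ 2 / τ)
      have h3 : Filter.Tendsto (fun n : ℕ => ((n : ℝ) + 3) / (n + 4)) Filter.atTop (nhds 1) := by
        have h4 := (tendsto_one_div_add_atTop_nhds_zero_nat (𝕜 := ℝ)).comp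
          (Filter.tendsto_add_atTop_nat 3)
        have h5 := h4.const_sub 1
        rw [sub_zero] at h5
        refine h5.congr fun n => ?_
        simp only [Function.comp_apply]
        push_cast
        have : (n : ℝ) + 4 ≠ 0 := by positivity
        field_simp
        ring
      have h4 := ((((h3.const_mul (4 * ‖z‖ ^ 2 / τ ^ 2)).mul h1).sub
        (h2.const_mul (2 * d / τ))).const_mul (v z))
      convert! h4 using 2
      ring
  have hr : Filter.Tendsto (fun n : ℕ => ∫ z, Laplacian.laplacian v z *
      truncExp (n + 4) (n + 4) (‖z‖ ^ 2 / τ)) Filter.atTop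
      (nhds (∫ z, Laplacian.laplacian v z * Real.exp (-(‖z‖ ^ 2 / τ)))) := by
    refine tendsto_integral_of_dominated_convergence
      (fun z => K * ((1 + ‖z‖ ^ 2) * Real.exp (ε * ‖z‖) * Real.exp (-(1 / (2 * τ)) * ‖z‖ ^ 2)))
      (fun n => ?_) (hint.const_mul _) (fun n => Filter.Eventually.of_forall fun z => ?_)
      (Filter.Eventually.of_forall fun z => ?_)
    · have h2 := continuous_truncExp (n + 4) (n + 4)
      exact Continuous.aestronglyMeasurable (by fun_prop)
    · rw [norm_mul, Real.norm_of_nonneg (truncExp_nonneg _ _ _)]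
      calc _ ≤ (K * Real.exp (ε * ‖z‖)) * Real.exp (-(1 / (2 * τ)) * ‖z‖ ^ 2) := by
            gcongr
            · exact truncExp_nonneg _ _ _
            · exact hLK z
            · exact hbd n (n + 4) (by omega) z
        _ ≤ (K * Real.exp (ε * ‖z‖)) * Real.exp (-(1 / (2 * τ)) * ‖z‖ ^ 2)
            + ‖z‖ ^ 2 * ((K * Real.exp (ε * ‖z‖)) * Real.exp (-(1 / (2 * τ)) * ‖z‖ ^ 2)) :=
          le_add_of_nonneg_right (by positivity)
        _ = _ := by ring
    · exact (tendsto_truncExp 0 (‖z‖ ^ 2 / τ)).const_mul _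
  exact tendsto_nhds_unique hl (hr.congr fun n => (hgreen n).symm)

end heat

end EllipticMLP

namespace EllipticMLP

/-! ### The heat semigroup -/

section gaussian

variable {d : ℕ}

/-- The Gaussian measure of covariance `2 t` has the heat kernel as its density. -/
lemma map_smul_stdGaussian {t : ℝ} (ht : 0 < t) :
    (stdGaussian (EuclideanSpace ℝ (Fin d))).map (fun z => √(2 * t) • z)
      = volume.withDensity fun z => ENNReal.ofReal
          ((4 * Real.pi * t) ^ (-(d / 2 : ℝ)) * Real.exp (-(‖z‖ ^ 2 / (4 * t)))) := by
  have hpi := Real.pi_pos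
  have hint : Integrable fun z : EuclideanSpace ℝ (Fin d) =>
      (4 * Real.pi * t) ^ (-(d / 2 : ℝ)) * Real.exp (-(‖z‖ ^ 2 / (4 * t))) := by
    refine ((integrable_exp_neg_mul_norm_sq (d := d) (b := 1 / (4 * t))
      (by positivity)).const_mul ((4 * Real.pi * t) ^ (-(d / 2 : ℝ)))).congr
        (Filter.Eventually.of_forall fun z => ?_)
    simp only
    congr 2
    ring
  have : IsFiniteMeasure ((volume : Measure (EuclideanSpace ℝ (Fin d))).withDensity
      fun z => ENNReal.ofReal
          ((4 * Real.pi * t) ^ (-(d / 2 : ℝ)) * Real.exp (-(‖z‖ ^ 2 / (4 * t))))) :=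
    isFiniteMeasure_withDensity_ofReal hint.2
  have : IsProbabilityMeasure ((stdGaussian (EuclideanSpace ℝ (Fin d))).map
      (fun z => √(2 * t) • z)) :=
    Measure.isProbabilityMeasure_map (by fun_prop)
  refine Measure.ext_of_charFun ?_
  ext ξ
  have h1 : charFun ((stdGaussian (EuclideanSpace ℝ (Fin d))).map
      (fun z => √(2 * t) • z)) ξ = Complex.exp (-(t * ‖ξ‖ ^ 2)) := by
    rw [charFun_map_smul, charFun_stdGaussian, norm_smul, Real.norm_of_nonneg (by positivity)]
    congr 1
    have : ((√(2 * t) * ‖ξ‖ : ℝ) : ℂ) ^ 2 = ((2 * t * ‖ξ‖ ^ 2 : ℝ) : ℂ) := by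
      rw [← Complex.ofReal_pow, mul_pow, Real.sq_sqrt (by positivity)]
    rw [this]
    push_cast
    ring
  rw [h1, charFun_apply, integral_withDensity_eq_integral_toReal_smul (by fun_prop)
    (Filter.Eventually.of_forall fun _ => ENNReal.ofReal_lt_top)]
  have h2 := GaussianFourier.integral_cexp_neg_mul_sq_norm_add (b := ((1 / (4 * t) : ℝ) : ℂ))
    (by rw [Complex.ofReal_re]; positivity) Complex.I ξ
  have h3 : ∀ z : EuclideanSpace ℝ (Fin d), (ENNReal.ofReal
          ((4 * Real.pi * t) ^ (-(d / 2 : ℝ)) * Real.exp (-(‖z‖ ^ 2 / (4 * t))))).toReal •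
          Complex.exp (inner ℝ z ξ * Complex.I)
        = (((4 * Real.pi * t) ^ (-(d / 2 : ℝ)) : ℝ) : ℂ) * Complex.exp
          (-((1 / (4 * t) : ℝ) : ℂ) * ‖z‖ ^ 2 + Complex.I * inner ℝ ξ z) := by
    intro z
    rw [ENNReal.toReal_ofReal (by positivity), Complex.real_smul, Complex.ofReal_mul, mul_assoc,
      Complex.ofReal_exp, ← Complex.exp_add, real_inner_comm]
    congr 2
    push_cast
    ring
  simp_rw [h3]
  rw [integral_const_mul, h2, ← mul_assoc, Complex.I_sq]
  have h4 : (((4 * Real.pi * t) ^ (-(d / 2 : ℝ)) : ℝ) : ℂ) * (Real.pi / ((1 / (4 * t) : ℝ) : ℂ)) ^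
      ((Module.finrank ℝ (EuclideanSpace ℝ (Fin d)) : ℂ) / 2) = 1 := by
    rw [finrank_euclideanSpace, Fintype.card_fin, ← Complex.ofReal_div,
      show Real.pi / (1 / (4 * t)) = 4 * Real.pi * t by field_simp,
      show ((d : ℂ) / 2) = ((d / 2 : ℝ) : ℂ) by push_cast; ring,
      ← Complex.ofReal_cpow (by positivity), ← Complex.ofReal_mul, ← Real.rpow_add (by positivity)]
    simp
  rw [h4, one_mul]
  congr 1
  push_cast
  have : (t : ℂ) ≠ 0 := by exact_mod_cast ht.ne'
  field_simp

lemma integral_stdGaussian_smul {t : ℝ} (ht : 0 < t) {F : EuclideanSpace ℝ (Fin d) → ℝ}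
    (hF : Continuous F) :
    ∫ z, F (√(2 * t) • z) ∂(stdGaussian (EuclideanSpace ℝ (Fin d)))
      = (4 * Real.pi * t) ^ (-(d / 2 : ℝ)) * ∫ z, F z * Real.exp (-(‖z‖ ^ 2 / (4 * t))) := by
  have hpi := Real.pi_pos
  have h1 := integral_map (μ := stdGaussian (EuclideanSpace ℝ (Fin d)))
    (φ := fun z => √(2 * t) • z) (by fun_prop) hF.aestronglyMeasurable
  rw [← h1, map_smul_stdGaussian ht, integral_withDensity_eq_integral_toReal_smul (by fun_prop)
    (Filter.Eventually.of_forall fun _ => ENNReal.ofReal_lt_top), ← integral_const_mul]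
  refine integral_congr_ae (Filter.Eventually.of_forall fun z => ?_)
  simp only
  rw [ENNReal.toReal_ofReal (by positivity), smul_eq_mul]
  ring

lemma integrable_exp_norm_stdGaussian (c : ℝ) :
    Integrable (fun z => Real.exp (c * ‖z‖)) (stdGaussian (EuclideanSpace ℝ (Fin d))) := by
  have hpi := Real.pi_pos
  -- Time `1 / 2` makes the scaling factor `√(2 t)` equal to one.
  have h0 : stdGaussian (EuclideanSpace ℝ (Fin d))
      = (stdGaussian (EuclideanSpace ℝ (Fin d))).map (fun z => √(2 * (1 / 2)) • z) := by simp
  rw [h0, map_smul_stdGaussian (by norm_num), integrable_withDensity_iff_integrable_smul'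
    (by fun_prop) (Filter.Eventually.of_forall fun _ => ENNReal.ofReal_lt_top)]
  refine Integrable.mono' ((integrable_one_add_sq_mul_exp (d := d) (b := 1 / 2) (by norm_num)
    c).const_mul ((4 * Real.pi * (1 / 2)) ^ (-(d / 2 : ℝ)))) (by fun_prop)
    (Filter.Eventually.of_forall fun z => ?_)
  rw [ENNReal.toReal_ofReal (by positivity), smul_eq_mul, Real.norm_of_nonneg (by positivity)]
  have h1 : Real.exp (-(‖z‖ ^ 2 / (4 * (1 / 2)))) = Real.exp (-(1 / 2) * ‖z‖ ^ 2) := by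
    congr 1; ring
  rw [h1, mul_assoc]
  refine mul_le_mul_of_nonneg_left ?_ (by positivity)
  rw [mul_comm (Real.exp _), mul_assoc]
  exact le_mul_of_one_le_left (by positivity) (by nlinarith [norm_nonneg z])

/-- The heat flow solves the heat equation at the origin. -/
lemma hasDerivAt_heat {v : EuclideanSpace ℝ (Fin d) → ℝ} (hv : ContDiff ℝ 2 v) {K ε : ℝ}
    (hvK : ∀ z, |v z| ≤ K * Real.exp (ε * ‖z‖))
    (hLK : ∀ z, |Laplacian.laplacian v z| ≤ K * Real.exp (ε * ‖z‖)) {t : ℝ} (ht : 0 < t) :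
    HasDerivAt (fun t => ∫ z, v (√(2 * t) • z) ∂(stdGaussian (EuclideanSpace ℝ (Fin d))))
      (∫ z, Laplacian.laplacian v (√(2 * t) • z) ∂(stdGaussian (EuclideanSpace ℝ (Fin d)))) t := by
  have hpi := Real.pi_pos
  have hLc : Continuous (Laplacian.laplacian v) := by
    rw [InnerProductSpace.laplacian_eq_iteratedFDeriv_orthonormalBasis v
      (EuclideanSpace.basisFun (Fin d) ℝ)]
    have := hv.continuous_iteratedFDeriv (m := 2) le_rfl
    fun_prop
  have hvc := hv.continuous
  have hK : 0 ≤ K := by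
    have := (abs_nonneg _).trans (hvK 0)
    simpa using this
  have hΦ : Integrable (fun z => v z * (‖z‖ ^ 2 / (4 * t ^ 2) * Real.exp (-(‖z‖ ^ 2 / (4 * t)))))
      ∧ HasDerivAt (fun t => ∫ z, v z * Real.exp (-(‖z‖ ^ 2 / (4 * t))))
      (∫ z, v z * (‖z‖ ^ 2 / (4 * t ^ 2) * Real.exp (-(‖z‖ ^ 2 / (4 * t))))) t := by
    have hint := integrable_one_add_sq_mul_exp (d := d) (b := 1 / (8 * t)) (by positivity) ε
    -- For `s` in this window, `s < 2 t` gives a common Gaussian majorant and `s > t / 2` bounds the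
    -- prefactor `1 / (4 s ^ 2)` by `1 / t ^ 2`.
    have hle : ∀ s ∈ Set.Ioo (t / 2) (2 * t), ∀ z : EuclideanSpace ℝ (Fin d),
        Real.exp (-(‖z‖ ^ 2 / (4 * s))) ≤ Real.exp (-(1 / (8 * t)) * ‖z‖ ^ 2) := by
      intro s hs z
      have hs0 : 0 < s := by linarith [hs.1]
      refine Real.exp_le_exp.2 ?_
      rw [neg_mul, neg_le_neg_iff, div_mul_eq_mul_div, one_mul]
      exact div_le_div_of_nonneg_left (by positivity) (by positivity) (by linarith [hs.2])
    refine hasDerivAt_integral_of_dominated_loc_of_deriv_le (s := Set.Ioo (t / 2) (2 * t))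
      (bound := fun z => K * (1 / t ^ 2) *
        ((1 + ‖z‖ ^ 2) * Real.exp (ε * ‖z‖) * Real.exp (-(1 / (8 * t)) * ‖z‖ ^ 2)))
      (F' := fun s z => v z * (‖z‖ ^ 2 / (4 * s ^ 2) * Real.exp (-(‖z‖ ^ 2 / (4 * s)))))
      (Ioo_mem_nhds (by linarith) (by linarith))
      (Filter.Eventually.of_forall fun s => Continuous.aestronglyMeasurable (by fun_prop)) ?_
      (Continuous.aestronglyMeasurable (by fun_prop))
      (Filter.Eventually.of_forall fun z s hs => ?_) (hint.const_mul _)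
      (Filter.Eventually.of_forall fun z s hs => ?_)
    · refine Integrable.mono' (hint.const_mul K) (Continuous.aestronglyMeasurable (by fun_prop))
        (Filter.Eventually.of_forall fun z => ?_)
      rw [norm_mul, Real.norm_of_nonneg (Real.exp_pos _).le]
      calc _ ≤ (K * Real.exp (ε * ‖z‖)) * Real.exp (-(1 / (8 * t)) * ‖z‖ ^ 2) :=
            mul_le_mul (hvK z) (hle t ⟨by linarith, by linarith⟩ z) (Real.exp_pos _).le
              (by positivity)
        _ ≤ (K * Real.exp (ε * ‖z‖)) * Real.exp (-(1 / (8 * t)) * ‖z‖ ^ 2)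
            + ‖z‖ ^ 2 * ((K * Real.exp (ε * ‖z‖)) * Real.exp (-(1 / (8 * t)) * ‖z‖ ^ 2)) :=
          le_add_of_nonneg_right (by positivity)
        _ = _ := by ring
    · have hs0 : 0 < s := by linarith [hs.1]
      have h1 : ‖z‖ ^ 2 / (4 * s ^ 2) ≤ 1 / t ^ 2 * (1 + ‖z‖ ^ 2) := by
        have h2 : t ^ 2 ≤ 4 * s ^ 2 := by nlinarith [hs.1]
        calc ‖z‖ ^ 2 / (4 * s ^ 2) ≤ (1 + ‖z‖ ^ 2) / t ^ 2 :=
              div_le_div₀ (by positivity) (by linarith) (by positivity) h2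
          _ = _ := by ring
      rw [norm_mul, norm_mul, Real.norm_of_nonneg (Real.exp_pos _).le,
        Real.norm_of_nonneg (show 0 ≤ ‖z‖ ^ 2 / (4 * s ^ 2) by positivity)]
      calc _ ≤ (K * Real.exp (ε * ‖z‖)) * ((1 / t ^ 2 * (1 + ‖z‖ ^ 2)) *
              Real.exp (-(1 / (8 * t)) * ‖z‖ ^ 2)) :=
            mul_le_mul (hvK z) (mul_le_mul h1 (hle s hs z) (Real.exp_pos _).le (by positivity))
              (by positivity) (by positivity)
        _ = _ := by ring
    · have hs0 : s ≠ 0 := by linarith [hs.1]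
      have h1 : HasDerivAt (fun s : ℝ => -(‖z‖ ^ 2 / (4 * s))) (‖z‖ ^ 2 / (4 * s ^ 2)) s := by
        have h2 := ((hasDerivAt_inv hs0).const_mul (‖z‖ ^ 2 / 4)).neg
        refine (h2.congr_deriv ?_).congr_of_eventuallyEq (Filter.Eventually.of_forall fun r => ?_)
        · ring
        · simp only [Pi.neg_apply]
          ring
      refine (h1.exp.const_mul (v z)).congr_deriv ?_
      ring
  have hpow : HasDerivAt (fun t : ℝ => (4 * Real.pi * t) ^ (-(d / 2 : ℝ)))
      (-(d / (2 * t)) * (4 * Real.pi * t) ^ (-(d / 2 : ℝ))) t := by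
    have h1 := ((hasDerivAt_id t).const_mul (4 * Real.pi)).rpow_const (p := -(d / 2 : ℝ))
      (Or.inl (by simp only [id]; positivity))
    refine h1.congr_deriv ?_
    simp only [id]
    rw [Real.rpow_sub_one (by positivity)]
    field_simp
  have hint0 : Integrable fun z : EuclideanSpace ℝ (Fin d) =>
      v z * Real.exp (-(‖z‖ ^ 2 / (4 * t))) := by
    have hint := integrable_one_add_sq_mul_exp (d := d) (b := 1 / (4 * t)) (by positivity) ε
    refine Integrable.mono' (hint.const_mul K) (Continuous.aestronglyMeasurable (by fun_prop))
      (Filter.Eventually.of_forall fun z => ?_)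
    rw [norm_mul, Real.norm_of_nonneg (Real.exp_pos _).le,
      show -(‖z‖ ^ 2 / (4 * t)) = -(1 / (4 * t)) * ‖z‖ ^ 2 by ring]
    calc _ ≤ (K * Real.exp (ε * ‖z‖)) * Real.exp (-(1 / (4 * t)) * ‖z‖ ^ 2) :=
          mul_le_mul_of_nonneg_right (hvK z) (Real.exp_pos _).le
      _ ≤ (K * Real.exp (ε * ‖z‖)) * Real.exp (-(1 / (4 * t)) * ‖z‖ ^ 2)
          + ‖z‖ ^ 2 * ((K * Real.exp (ε * ‖z‖)) * Real.exp (-(1 / (4 * t)) * ‖z‖ ^ 2)) :=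
        le_add_of_nonneg_right (by positivity)
      _ = _ := by ring
  have hprod := hpow.mul hΦ.2
  have hcongr : (fun t => ∫ z, v (√(2 * t) • z) ∂(stdGaussian (EuclideanSpace ℝ (Fin d))))
      =ᶠ[nhds t] (fun t : ℝ => (4 * Real.pi * t) ^ (-(d / 2 : ℝ))) *
        fun t => ∫ z, v z * Real.exp (-(‖z‖ ^ 2 / (4 * t))) := by
    filter_upwards [Ioi_mem_nhds ht] with s hs
    exact integral_stdGaussian_smul hs hvc
  refine (hprod.congr_of_eventuallyEq hcongr).congr_deriv ?_
  -- With `τ = 4 t` the Laplacian of the kernel has the factor `‖z‖² / (4 t²) - d / (2 t)`, which is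
  -- also the logarithmic time derivative of the normalized kernel.
  rw [integral_stdGaussian_smul ht hLc, ← integral_mul_heat_eq hv hvK hLK (τ := 4 * t)
    (by positivity)]
  have h1 : ∀ z : EuclideanSpace ℝ (Fin d),
      v z * ((4 * ‖z‖ ^ 2 / (4 * t) ^ 2 - 2 * d / (4 * t)) * Real.exp (-(‖z‖ ^ 2 / (4 * t))))
      = v z * (‖z‖ ^ 2 / (4 * t ^ 2) * Real.exp (-(‖z‖ ^ 2 / (4 * t))))
        - d / (2 * t) * (v z * Real.exp (-(‖z‖ ^ 2 / (4 * t)))) := by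
    intro z
    have : t ≠ 0 := ht.ne'
    field_simp
    ring
  simp_rw [h1]
  rw [integral_sub hΦ.1 (hint0.const_mul _), integral_const_mul]
  ring

/-- Dominated convergence on `t ≤ 1`. It supplies the initial value of the heat flow, where the time
derivative formula is not available. -/
lemma continuousWithinAt_heat {v : EuclideanSpace ℝ (Fin d) → ℝ} (hv : Continuous v) {K ε : ℝ}
    (hε : 0 ≤ ε) (hvK : ∀ z, |v z| ≤ K * Real.exp (ε * ‖z‖)) :
    ContinuousWithinAt (fun t => ∫ z, v (√(2 * t) • z) ∂(stdGaussian (EuclideanSpace ℝ (Fin d))))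
      (Set.Ici 0) 0 := by
  have hK : 0 ≤ K := by
    have := (abs_nonneg _).trans (hvK 0)
    simpa using this
  refine continuousWithinAt_of_dominated (bound := fun z => K * Real.exp (ε * √2 * ‖z‖))
    (Filter.Eventually.of_forall fun t => Continuous.aestronglyMeasurable (by fun_prop)) ?_
    ((integrable_exp_norm_stdGaussian _).const_mul _)
    (Filter.Eventually.of_forall fun z => Continuous.continuousWithinAt (by fun_prop))
  have : ∀ᶠ t in nhdsWithin (0 : ℝ) (Set.Ici 0), t ≤ 1 :=
    nhdsWithin_le_nhds (Iic_mem_nhds zero_lt_one)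
  filter_upwards [this] with t ht
  refine Filter.Eventually.of_forall fun z => (hvK _).trans ?_
  gcongr K * Real.exp ?_
  rw [norm_smul, Real.norm_of_nonneg (Real.sqrt_nonneg _), mul_assoc]
  gcongr
  linarith

end gaussian

end EllipticMLP

namespace EllipticMLP

/-! ### The weight and the resolvent of the Laplacian -/

/-! ### Exponential random times -/

section expMeasure

lemma lintegral_expMeasure {r : ℝ} {f : ℝ → ENNReal} (hf : Measurable f) :
    ∫⁻ t, f t ∂(expMeasure r) = ∫⁻ t, exponentialPDF r t * f t := by
  have hm : Measurable (exponentialPDF r) := (measurable_exponentialPDFReal r).ennreal_ofReal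
  exact lintegral_withDensity_eq_lintegral_mul _ hm hf

lemma integral_expMeasure {r : ℝ} (hr : 0 < r) (f : ℝ → ℝ) :
    ∫ t, f t ∂(expMeasure r) = ∫ t in Set.Ioi 0, r * Real.exp (-(r * t)) * f t := by
  have hm : Measurable (exponentialPDF r) := (measurable_exponentialPDFReal r).ennreal_ofReal
  have h1 : ∫ t, f t ∂(expMeasure r) = ∫ t, (exponentialPDF r t).toReal • f t :=
    integral_withDensity_eq_integral_toReal_smul hm
      (Filter.Eventually.of_forall fun _ => ENNReal.ofReal_lt_top) f
  rw [h1, ← integral_Ici_eq_integral_Ioi, ← integral_indicator measurableSet_Ici]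
  refine integral_congr_ae (Filter.Eventually.of_forall fun t => ?_)
  simp only [exponentialPDF_eq, Set.indicator, Set.mem_Ici, smul_eq_mul]
  split_ifs
  · rw [ENNReal.toReal_ofReal (by positivity)]
  · simp

lemma ae_nonneg_expMeasure (r : ℝ) : ∀ᵐ t ∂(expMeasure r), 0 ≤ t := by
  have hs : MeasurableSet {t : ℝ | ¬ 0 ≤ t} := measurableSet_Ici.compl
  rw [ae_iff, ← lintegral_indicator_one hs, lintegral_expMeasure (measurable_one.indicator hs)]
  refine (lintegral_congr fun t => ?_).trans lintegral_zero
  by_cases ht : 0 ≤ t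
  · simp [Set.indicator, not_lt.2 ht]
  · simp [exponentialPDF_of_neg (not_le.1 ht)]

/-- Tilting the exponential density of rate `r` by `exp (c t)` yields, up to the constant, the one
of rate `r - c`. -/
lemma lintegral_exp_mul_expMeasure {r c : ℝ} (hr : 0 < r) (hc : c < r) :
    ∫⁻ t, ENNReal.ofReal (Real.exp (c * t)) ∂(expMeasure r) = ENNReal.ofReal (r / (r - c)) := by
  have hrc : 0 < r - c := sub_pos.2 hc
  rw [lintegral_expMeasure (by fun_prop)]
  have h1 : ∀ t, exponentialPDF r t * ENNReal.ofReal (Real.exp (c * t))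
      = ENNReal.ofReal (r / (r - c)) * exponentialPDF (r - c) t := by
    intro t
    rcases lt_or_ge t 0 with ht | ht
    · rw [exponentialPDF_of_neg ht, exponentialPDF_of_neg ht, zero_mul, mul_zero]
    · rw [exponentialPDF_of_nonneg ht, exponentialPDF_of_nonneg ht,
        ← ENNReal.ofReal_mul (by positivity), ← ENNReal.ofReal_mul (by positivity), mul_assoc,
        ← Real.exp_add]
      congr 1
      rw [show -(r * t) + c * t = -((r - c) * t) by ring]
      field_simp
  simp_rw [h1]
  have hm : Measurable (exponentialPDF (r - c)) :=
    (measurable_exponentialPDFReal (r - c)).ennreal_ofReal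
  rw [lintegral_const_mul _ hm,
    lintegral_exponentialPDF_eq_one hrc, mul_one]

end expMeasure

/-! ### The weight and its Gaussian averages -/

section weight

variable {d : ℕ}

/-- The weight `∑ⱼ cosh (ε xⱼ)`, an eigenfunction of the Laplacian. -/
noncomputable def weight (ε : ℝ) (x : EuclideanSpace ℝ (Fin d)) : ℝ := ∑ j, Real.cosh (ε * x j)

lemma weight_nonneg (ε : ℝ) (x : EuclideanSpace ℝ (Fin d)) : 0 ≤ weight ε x :=
  Finset.sum_nonneg fun _ _ => (Real.cosh_pos _).le

@[fun_prop] lemma continuous_weight (ε : ℝ) :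
    Continuous (weight (d := d) ε) := by
  have := Real.continuous_cosh
  unfold weight
  fun_prop

lemma cosh_le_exp_abs (y : ℝ) : Real.cosh y ≤ Real.exp |y| := by
  rw [Real.cosh_eq]
  have h1 := Real.exp_le_exp.2 (le_abs_self y)
  have h2 := Real.exp_le_exp.2 (neg_le_abs y)
  linarith

lemma exp_abs_le_two_mul_cosh (y : ℝ) : Real.exp |y| ≤ 2 * Real.cosh y := by
  rw [Real.cosh_eq]
  rcases abs_cases y with ⟨h, _⟩ | ⟨h, _⟩ <;> rw [h] <;>
    linarith [Real.exp_pos y, Real.exp_pos (-y)]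

lemma weight_add_le {ε : ℝ} (hε : 0 ≤ ε) (x z : EuclideanSpace ℝ (Fin d)) :
    weight ε (x + z) ≤ (∑ j, Real.exp (ε * |x j|)) * Real.exp (ε * ‖z‖) := by
  unfold weight
  rw [Finset.sum_mul]
  refine Finset.sum_le_sum fun j _ => (cosh_le_exp_abs _).trans ?_
  rw [← Real.exp_add, abs_mul, abs_of_nonneg hε, ← mul_add]
  refine Real.exp_le_exp.2 (mul_le_mul_of_nonneg_left ?_ hε)
  have h1 : |z j| ≤ ‖z‖ := by simpa using PiLp.norm_apply_le z j
  exact (abs_add_le (x j) (z j)).trans (by linarith)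

lemma map_coord_stdGaussian (j : Fin d) :
    (stdGaussian (EuclideanSpace ℝ (Fin d))).map (fun z => z j) = gaussianReal 0 1 := by
  rw [← map_pi_eq_stdGaussian, Measure.map_map (by fun_prop) (by fun_prop)]
  exact (measurePreserving_eval (fun _ : Fin d => gaussianReal 0 1) j).map_eq

lemma integrable_exp_coord_stdGaussian (s : ℝ) (j : Fin d) :
    Integrable (fun z => Real.exp (s * z j)) (stdGaussian (EuclideanSpace ℝ (Fin d))) := by
  have h := integrable_exp_mul_gaussianReal (μ := 0) (v := 1) s
  rw [← map_coord_stdGaussian j] at h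
  exact h.comp_measurable (by fun_prop)

lemma integral_exp_coord_stdGaussian (s : ℝ) (j : Fin d) :
    ∫ z, Real.exp (s * z j) ∂(stdGaussian (EuclideanSpace ℝ (Fin d))) = Real.exp (s ^ 2 / 2) := by
  have h := mgf_gaussianReal (map_coord_stdGaussian j) s
  rw [mgf] at h
  rw [h]
  simp

/-- Splitting each `cosh` into exponentials reduces Gaussian averages of the weight to the
one-dimensional moment generating function. -/
lemma weight_add_smul (ε s : ℝ) (x z : EuclideanSpace ℝ (Fin d)) :
    weight ε (x + s • z) = ∑ j, (Real.exp (ε * x j) / 2 * Real.exp (ε * s * z j)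
      + Real.exp (-(ε * x j)) / 2 * Real.exp (-(ε * s) * z j)) := by
  unfold weight
  refine Finset.sum_congr rfl fun j _ => ?_
  rw [Real.cosh_eq, div_mul_eq_mul_div, div_mul_eq_mul_div, ← Real.exp_add, ← Real.exp_add,
    ← add_div]
  simp only [PiLp.add_apply, PiLp.smul_apply, smul_eq_mul]
  ring_nf

lemma integrable_weight_add_smul (ε s : ℝ) (x : EuclideanSpace ℝ (Fin d)) :
    Integrable (fun z => weight ε (x + s • z)) (stdGaussian (EuclideanSpace ℝ (Fin d))) := by
  simp_rw [weight_add_smul]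
  exact integrable_finsetSum _ fun j _ =>
    ((integrable_exp_coord_stdGaussian _ j).const_mul _).add
      ((integrable_exp_coord_stdGaussian _ j).const_mul _)

lemma integral_weight_add_smul (ε s : ℝ) (x : EuclideanSpace ℝ (Fin d)) :
    ∫ z, weight ε (x + s • z) ∂(stdGaussian (EuclideanSpace ℝ (Fin d)))
      = Real.exp (ε ^ 2 * s ^ 2 / 2) * weight ε x := by
  have hi : ∀ j, Integrable (fun z : EuclideanSpace ℝ (Fin d) =>
      Real.exp (ε * x j) / 2 * Real.exp (ε * s * z j)
        + Real.exp (-(ε * x j)) / 2 * Real.exp (-(ε * s) * z j))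
      (stdGaussian (EuclideanSpace ℝ (Fin d))) := fun j =>
    ((integrable_exp_coord_stdGaussian _ j).const_mul _).add
      ((integrable_exp_coord_stdGaussian _ j).const_mul _)
  simp_rw [weight_add_smul]
  rw [integral_finsetSum _ fun j _ => hi j, weight, Finset.mul_sum]
  refine Finset.sum_congr rfl fun j _ => ?_
  rw [integral_add ((integrable_exp_coord_stdGaussian _ j).const_mul _)
    ((integrable_exp_coord_stdGaussian _ j).const_mul _), integral_const_mul, integral_const_mul,
    integral_exp_coord_stdGaussian, integral_exp_coord_stdGaussian, neg_sq, Real.cosh_eq, mul_pow]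
  ring

end weight

/-! ### The resolvent kernel and the Feynman–Kac formula -/

section resolvent

variable {d : ℕ}

/-- The law of `√2 W_R` for a standard Brownian motion `W` and an independent exponentially
distributed time `R` of rate `lam`. -/
noncomputable def resolventMeasure (lam : ℝ) (d : ℕ) : Measure (EuclideanSpace ℝ (Fin d)) :=
  ((expMeasure lam).prod (stdGaussian (EuclideanSpace ℝ (Fin d)))).map fun p => √(2 * p.1) • p.2

lemma isProbabilityMeasure_resolventMeasure {lam : ℝ} (hlam : 0 < lam) :
    IsProbabilityMeasure (resolventMeasure lam d) := by
  have := isProbabilityMeasure_expMeasure hlam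
  exact Measure.isProbabilityMeasure_map (by fun_prop)

/-- The heat flow multiplies the weight by `exp (ε² t)`, and averaging this over the exponential
time gives `lam / (lam - ε²)`. The factor does not involve `d`. -/
lemma lintegral_weight_resolventMeasure {lam ε : ℝ} (hlam : 0 < lam) (hε : ε ^ 2 < lam)
    (x : EuclideanSpace ℝ (Fin d)) :
    ∫⁻ y, ENNReal.ofReal (weight ε (x + y)) ∂(resolventMeasure lam d)
      = ENNReal.ofReal (lam / (lam - ε ^ 2) * weight ε x) := by
  have := isProbabilityMeasure_expMeasure hlam
  have hpos : 0 < lam - ε ^ 2 := sub_pos.2 hε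
  have hm : Continuous fun y : EuclideanSpace ℝ (Fin d) => weight ε (x + y) := by fun_prop
  have hm' : Continuous fun p : ℝ × EuclideanSpace ℝ (Fin d) =>
      weight ε (x + √(2 * p.1) • p.2) := by fun_prop
  rw [resolventMeasure, lintegral_map hm.measurable.ennreal_ofReal (by fun_prop),
    lintegral_prod _ hm'.measurable.ennreal_ofReal.aemeasurable]
  have h1 : ∀ᵐ t ∂(expMeasure lam),
      ∫⁻ z, ENNReal.ofReal (weight ε (x + √(2 * t) • z)) ∂(stdGaussian (EuclideanSpace ℝ (Fin d)))
        = ENNReal.ofReal (Real.exp (ε ^ 2 * t)) * ENNReal.ofReal (weight ε x) := by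
    filter_upwards [ae_nonneg_expMeasure lam] with t ht
    rw [← ofReal_integral_eq_lintegral_ofReal (integrable_weight_add_smul _ _ _)
      (Filter.Eventually.of_forall fun z => weight_nonneg _ _), integral_weight_add_smul,
      Real.sq_sqrt (by positivity), ENNReal.ofReal_mul (Real.exp_pos _).le]
    congr 3
    ring
  rw [lintegral_congr_ae h1, lintegral_mul_const _ (by fun_prop),
    lintegral_exp_mul_expMeasure hlam hε, ENNReal.ofReal_mul (by positivity)]

lemma laplacian_comp_const_add (u : EuclideanSpace ℝ (Fin d) → ℝ) (x z : EuclideanSpace ℝ (Fin d)) :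
    Laplacian.laplacian (fun z => u (x + z)) z = Laplacian.laplacian u (x + z) := by
  rw [InnerProductSpace.laplacian_eq_iteratedFDeriv_orthonormalBasis _
      (EuclideanSpace.basisFun (Fin d) ℝ),
    InnerProductSpace.laplacian_eq_iteratedFDeriv_orthonormalBasis _
      (EuclideanSpace.basisFun (Fin d) ℝ)]
  simp only [iteratedFDeriv_comp_add_left]

/-- The Feynman–Kac representation `u = (lam - Δ)⁻¹ (lam - Δ) u`. -/
theorem eq_integral_resolventMeasure {u : EuclideanSpace ℝ (Fin d) → ℝ} (hu : ContDiff ℝ 2 u)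
    {lam ε K : ℝ} (hlam : 0 < lam) (hε0 : 0 ≤ ε) (hε : ε ^ 2 < lam)
    (huK : ∀ y, |u y| ≤ K * weight ε y)
    (hLK : ∀ y, |Laplacian.laplacian u y| ≤ K * weight ε y) (x : EuclideanSpace ℝ (Fin d)) :
    u x = ∫ y, (u (x + y) - Laplacian.laplacian u (x + y) / lam) ∂(resolventMeasure lam d) := by
  have := isProbabilityMeasure_expMeasure hlam
  have := isProbabilityMeasure_resolventMeasure (d := d) hlam
  have hpos : 0 < lam - ε ^ 2 := sub_pos.2 hε
  set γ := stdGaussian (EuclideanSpace ℝ (Fin d)) with hγ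
  set v : EuclideanSpace ℝ (Fin d) → ℝ := fun z => u (x + z) with hv
  set w : EuclideanSpace ℝ (Fin d) → ℝ := fun z => Laplacian.laplacian u (x + z) with hw
  have hvC : ContDiff ℝ 2 v := hu.comp (by fun_prop)
  have hLv : Laplacian.laplacian v = w := funext fun z => laplacian_comp_const_add u x z
  have hwc : Continuous w := by
    rw [← hLv, InnerProductSpace.laplacian_eq_iteratedFDeriv_orthonormalBasis v
      (EuclideanSpace.basisFun (Fin d) ℝ)]
    have := hvC.continuous_iteratedFDeriv (m := 2) le_rfl
    fun_prop
  have hvc := hvC.continuous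
  -- Cruder form of the bound, needed only to enter the heat flow lemmas; its constant may depend on
  -- `x` and `d`.
  have hbd : ∀ {g : EuclideanSpace ℝ (Fin d) → ℝ}, (∀ z, |g z| ≤ K * weight ε (x + z)) →
      ∀ z, |g z| ≤ |K| * (∑ j, Real.exp (ε * |x j|)) * Real.exp (ε * ‖z‖) := by
    intro g hg z
    refine (hg z).trans ?_
    rw [mul_assoc]
    exact mul_le_mul (le_abs_self K) (weight_add_le hε0 x z) (weight_nonneg _ _) (abs_nonneg K)
  have hvB : ∀ z, |v z| ≤ K * weight ε (x + z) := fun z => huK _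
  have hwB : ∀ z, |w z| ≤ K * weight ε (x + z) := fun z => hLK _
  set H : ℝ → ℝ := fun t => ∫ z, v (√(2 * t) • z) ∂γ with hH
  set J : ℝ → ℝ := fun t => ∫ z, w (√(2 * t) • z) ∂γ with hJ
  have hderiv : ∀ t, 0 < t → HasDerivAt H (J t) t := by
    intro t ht
    have h := hasDerivAt_heat hvC (hbd hvB) (hLv ▸ hbd hwB) ht
    rw [hLv] at h
    exact h
  -- The eigenfunction property limits the growth in time to `exp (ε² t)`, which `exp (-lam t)`
  -- beats.
  have hgrow : ∀ {g : EuclideanSpace ℝ (Fin d) → ℝ}, (∀ z, |g z| ≤ K * weight ε (x + z)) →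
      ∀ t, 0 ≤ t → |∫ z, g (√(2 * t) • z) ∂γ| ≤ K * weight ε x * Real.exp (ε ^ 2 * t) := by
    intro g hg t ht
    have h1 : |∫ z, g (√(2 * t) • z) ∂γ| ≤ ∫ z, K * weight ε (x + √(2 * t) • z) ∂γ :=
      norm_integral_le_of_norm_le (μ := γ) (f := fun z => g (√(2 * t) • z))
        (g := fun z => K * weight ε (x + √(2 * t) • z))
        ((integrable_weight_add_smul _ _ _).const_mul K)
        (Filter.Eventually.of_forall fun z => hg _)
    rw [integral_const_mul, integral_weight_add_smul, Real.sq_sqrt (by positivity)] at h1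
    refine h1.trans (le_of_eq ?_)
    rw [show ε ^ 2 * (2 * t) / 2 = ε ^ 2 * t by ring]
    ring
  have hHm : StronglyMeasurable H := by
    have h1 : Continuous fun p : ℝ × EuclideanSpace ℝ (Fin d) => v (√(2 * p.1) • p.2) := by
      fun_prop
    exact h1.stronglyMeasurable.integral_prod_right (ν := γ)
  have hJm : StronglyMeasurable J := by
    have h1 : Continuous fun p : ℝ × EuclideanSpace ℝ (Fin d) => w (√(2 * p.1) • p.2) := by
      fun_prop
    exact h1.stronglyMeasurable.integral_prod_right (ν := γ)
  set B := K * weight ε x with hB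
  have hB0 : 0 ≤ B := (abs_nonneg _).trans (huK x)
  -- the fundamental theorem of calculus for `t ↦ -exp (-lam t) H t`
  have hftc : ∫ t in Set.Ioi 0, (lam * Real.exp (-(lam * t)) * H t - Real.exp (-(lam * t)) * J t)
      = 0 - -(Real.exp (-(lam * 0)) * H 0) := by
    refine integral_Ioi_of_hasDerivAt_of_tendsto (f := fun t => -(Real.exp (-(lam * t)) * H t))
      ?_ (fun t ht => ?_) ?_ ?_
    · have h1 : ContinuousWithinAt H (Set.Ici 0) 0 :=
        continuousWithinAt_heat hvc hε0 (hbd hvB)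
      exact (ContinuousWithinAt.mul (Continuous.continuousWithinAt (by fun_prop)) h1).neg
    · have h1 : HasDerivAt (fun t : ℝ => -(lam * t)) (-lam) t := by
        simpa using (hasDerivAt_id t).const_mul (-lam)
      refine ((h1.exp.mul (hderiv t ht)).neg).congr_deriv ?_
      ring
    · refine Integrable.mono' (g := fun t => (lam + 1) * B * Real.exp (-(lam - ε ^ 2) * t))
        ((exp_neg_integrableOn_Ioi 0 hpos).const_mul _) ?_ ?_
      · have h1 := hHm.measurable
        have h2 := hJm.measurable
        exact Measurable.aestronglyMeasurable (by fun_prop)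
      · refine (ae_restrict_iff' measurableSet_Ioi).2 (Filter.Eventually.of_forall fun t ht => ?_)
        have ht0 : 0 ≤ t := le_of_lt ht
        have h1 := hgrow hvB t ht0
        have h2 := hgrow hwB t ht0
        have h3 : Real.exp (-(lam - ε ^ 2) * t) = Real.exp (-(lam * t)) * Real.exp (ε ^ 2 * t) := by
          rw [← Real.exp_add]
          ring_nf
        rw [h3]
        refine (norm_sub_le _ _).trans ?_
        rw [norm_mul (lam * Real.exp (-(lam * t))), norm_mul (Real.exp (-(lam * t))),
          Real.norm_of_nonneg (show 0 ≤ lam * Real.exp (-(lam * t)) by positivity),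
          Real.norm_of_nonneg (Real.exp_pos _).le]
        calc _ ≤ lam * Real.exp (-(lam * t)) * (B * Real.exp (ε ^ 2 * t))
              + Real.exp (-(lam * t)) * (B * Real.exp (ε ^ 2 * t)) :=
              add_le_add (mul_le_mul_of_nonneg_left h1 (by positivity))
                (mul_le_mul_of_nonneg_left h2 (by positivity))
          _ = _ := by ring
    · have h0 : Filter.Tendsto (fun t : ℝ => B * Real.exp (-((lam - ε ^ 2) * t))) Filter.atTop
          (nhds 0) := by
        have h1 := (Real.tendsto_exp_neg_atTop_nhds_zero.comp
          (Filter.tendsto_id.const_mul_atTop hpos)).const_mul B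
        simpa using h1
      refine squeeze_zero_norm' ?_ h0
      filter_upwards [Filter.eventually_ge_atTop 0] with t ht
      have h3 : Real.exp (-((lam - ε ^ 2) * t)) = Real.exp (-(lam * t)) * Real.exp (ε ^ 2 * t) := by
        rw [← Real.exp_add]
        ring_nf
      rw [norm_neg, norm_mul, Real.norm_of_nonneg (Real.exp_pos _).le, h3]
      calc _ ≤ Real.exp (-(lam * t)) * (B * Real.exp (ε ^ 2 * t)) :=
            mul_le_mul_of_nonneg_left (hgrow hvB t ht) (Real.exp_pos _).le
        _ = _ := by ring
  have hHi : ∀ {g : EuclideanSpace ℝ (Fin d) → ℝ}, Continuous g →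
      (∀ z, |g z| ≤ K * weight ε (x + z)) → ∀ t : ℝ, Integrable (fun z => g (√(2 * t) • z)) γ := by
    intro g hgc hg t
    exact ((integrable_weight_add_smul ε _ x).const_mul K).mono'
      (Continuous.aestronglyMeasurable (by fun_prop)) (Filter.Eventually.of_forall fun z => hg _)
  have hφc : Continuous fun y => v y - w y / lam := by fun_prop
  have hφi : Integrable (fun y => v y - w y / lam) (resolventMeasure lam d) := by
    have h1 : Integrable (fun y => weight ε (x + y)) (resolventMeasure lam d) := by
      refine ⟨Continuous.aestronglyMeasurable (by fun_prop), ?_⟩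
      rw [hasFiniteIntegral_iff_ofReal (Filter.Eventually.of_forall fun y => weight_nonneg _ _),
        lintegral_weight_resolventMeasure hlam hε]
      exact ENNReal.ofReal_lt_top
    exact ((h1.const_mul K).mono' hvc.aestronglyMeasurable
      (Filter.Eventually.of_forall hvB)).sub (((h1.const_mul K).mono' hwc.aestronglyMeasurable
      (Filter.Eventually.of_forall hwB)).div_const lam)
  have hmap : ∫ y, (v y - w y / lam) ∂(resolventMeasure lam d)
      = ∫ t, (H t - J t / lam) ∂(expMeasure lam) := by
    have h1 : AEMeasurable (fun p : ℝ × EuclideanSpace ℝ (Fin d) => √(2 * p.1) • p.2)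
      ((expMeasure lam).prod γ) := by fun_prop
    rw [resolventMeasure] at hφi ⊢
    rw [integral_map h1 hφc.aestronglyMeasurable, integral_prod]
    · refine integral_congr_ae (Filter.Eventually.of_forall fun t => ?_)
      simp only
      rw [integral_sub (hHi hvc hvB t) ((hHi hwc hwB t).div_const lam), integral_div]
    · exact (integrable_map_measure hφc.aestronglyMeasurable h1).1 hφi
  rw [show ∫ y, (u (x + y) - Laplacian.laplacian u (x + y) / lam) ∂(resolventMeasure lam d)
    = ∫ y, (v y - w y / lam) ∂(resolventMeasure lam d) from rfl, hmap, integral_expMeasure hlam]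
  have h2 : ∀ t, lam * Real.exp (-(lam * t)) * (H t - J t / lam)
      = lam * Real.exp (-(lam * t)) * H t - Real.exp (-(lam * t)) * J t := by
    intro t
    field_simp
  simp_rw [h2]
  rw [hftc]
  simp [hH, hv]

end resolvent

end EllipticMLP

namespace EllipticMLP

/-! ### The law of the driving noise -/

section noise

variable {Ω : Type*} [MeasurableSpace Ω] {P : Measure Ω}

/-- Freeze all the `X i` by Fubini: the events then concern the independent `Z i` and their
probabilities factor. The factors are functions of the independent `X i`, so the expectation factors
too. -/
lemma iIndepFun_prodMk {ι α β : Type*} [MeasurableSpace α] [MeasurableSpace β]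
    {X : ι → Ω → α} {Z : ι → Ω → β} (hXm : ∀ i, Measurable (X i)) (hZm : ∀ i, Measurable (Z i))
    (hX : iIndepFun X P) (hZ : iIndepFun Z P)
    (hXZ : IndepFun (fun ω i => X i ω) (fun ω i => Z i ω) P) :
    iIndepFun (fun i ω => (X i ω, Z i ω)) P := by
  have := hX.isProbabilityMeasure
  have hXm' : Measurable fun ω i => X i ω := measurable_pi_lambda _ hXm
  have hZm' : Measurable fun ω i => Z i ω := measurable_pi_lambda _ hZm
  rw [iIndepFun_iff_measure_inter_preimage_eq_mul]
  intro S t' ht'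
  classical
  -- The given sets are measurable only for indices in `S`; emptying the others makes the whole
  -- family measurable.
  obtain ⟨t, ht, htt⟩ : ∃ t : ι → Set (α × β), (∀ i, MeasurableSet (t i)) ∧ ∀ i ∈ S, t' i = t i :=
    ⟨fun i => if i ∈ S then t' i else ∅, fun i => by
      by_cases hi : i ∈ S <;> simp [hi, ht'], fun i hi => by simp [hi]⟩
  have hprod := (indepFun_iff_map_prod_eq_prod_map_map hXm'.aemeasurable hZm'.aemeasurable).1 hXZ
  have key : ∀ T : Finset ι, P (⋂ i ∈ T, (fun ω => (X i ω, Z i ω)) ⁻¹' t i)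
      = ∫⁻ ω, ∏ i ∈ T, P.map (Z i) (Prod.mk (X i ω) ⁻¹' t i) ∂P := by
    intro T
    have hA : MeasurableSet (⋂ i ∈ T, {p : (ι → α) × (ι → β) | (p.1 i, p.2 i) ∈ t i}) := by
      refine T.measurableSet_biInter fun i _ => ?_
      exact (ht i).preimage (f := fun p : (ι → α) × (ι → β) => (p.1 i, p.2 i)) (by fun_prop)
    have h1 : (⋂ i ∈ T, (fun ω => (X i ω, Z i ω)) ⁻¹' t i)
        = (fun ω => ((fun i => X i ω), (fun i => Z i ω))) ⁻¹'
          (⋂ i ∈ T, {p : (ι → α) × (ι → β) | (p.1 i, p.2 i) ∈ t i}) := by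
      ext ω; simp
    rw [h1, ← Measure.map_apply (hXm'.prodMk hZm') hA, hprod, Measure.prod_apply hA,
      lintegral_map (measurable_measure_prodMk_left hA) hXm']
    refine lintegral_congr fun ω => ?_
    have h2 : (Prod.mk (fun i => X i ω) ⁻¹'
        (⋂ i ∈ T, {p : (ι → α) × (ι → β) | (p.1 i, p.2 i) ∈ t i}))
        = ⋂ i ∈ T, {z : ι → β | z i ∈ Prod.mk (X i ω) ⁻¹' t i} := by
      ext z; simp
    have h3 : ∀ i, MeasurableSet (Prod.mk (X i ω) ⁻¹' t i) := fun i => measurable_prodMk_left (ht i)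
    rw [h2, Measure.map_apply hZm' (s := ⋂ i ∈ T, {z : ι → β | z i ∈ Prod.mk (X i ω) ⁻¹' t i})
      (T.measurableSet_biInter fun i _ => (measurable_pi_apply i) (h3 i))]
    have h4 := iIndepFun_iff_measure_inter_preimage_eq_mul.1 hZ T
      (sets := fun i => Prod.mk (X i ω) ⁻¹' t i) (fun i _ => h3 i)
    rw [Finset.prod_congr rfl fun i _ => Measure.map_apply (hZm i) (h3 i), ← h4]
    congr 1
    ext ω'; simp
  have hg : ∀ i, Measurable fun x => P.map (Z i) (Prod.mk x ⁻¹' t i) :=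
    fun i => measurable_measure_prodMk_left (ht i)
  have h5 := key S
  rw [lintegral_prod_eq_prod_lintegral_of_indepFun S
    (fun i ω => P.map (Z i) (Prod.mk (X i ω) ⁻¹' t i))
    (hX.comp (fun i x => P.map (Z i) (Prod.mk x ⁻¹' t i)) hg)
    (fun i => (hg i).comp (hXm i))] at h5
  have h6 : (⋂ i ∈ S, (fun ω => (X i ω, Z i ω)) ⁻¹' t' i)
      = ⋂ i ∈ S, (fun ω => (X i ω, Z i ω)) ⁻¹' t i :=
    Set.iInter₂_congr fun i hi => by rw [htt i hi]
  rw [h6, h5]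
  refine Finset.prod_congr rfl fun i hi => ?_
  have h7 := key {i}
  simp only [Finset.mem_singleton, Set.iInter_iInter_eq_left, Finset.prod_singleton] at h7
  rw [htt i hi, h7]

variable {d : ℕ}

/-- A jointly measurable evaluation of paths, which is the evaluation on continuous paths. -/
noncomputable def pathEval (p : ℝ≥0 × (ℝ≥0 → EuclideanSpace ℝ (Fin d))) :
    EuclideanSpace ℝ (Fin d) :=
  WithLp.toLp 2 fun i => Filter.limsup
    (fun n : ℕ => p.2 (⌊((n : ℝ≥0)) * p.1⌋₊ / (n : ℝ≥0)) i) Filter.atTop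

/-- The discretized time `⌊n r⌋ / n` runs through countably many values, and at each fixed time
evaluation is measurable for the product σ-algebra. -/
lemma measurable_pathEval : Measurable (pathEval (d := d)) := by
  refine (WithLp.measurable_toLp 2 _).comp (measurable_pi_lambda _ fun i => ?_)
  refine Measurable.limsup fun n => ?_
  have h1 : Measurable fun q : ℕ × (ℝ≥0 → EuclideanSpace ℝ (Fin d)) => q.2 (q.1 / (n : ℝ≥0)) i :=
    measurable_from_prod_countable_right fun k => by
      have : Measurable fun w : ℝ≥0 → EuclideanSpace ℝ (Fin d) => w (k / (n : ℝ≥0)) :=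
        measurable_pi_apply _
      exact (measurable_pi_apply i).comp ((WithLp.measurable_ofLp 2 _).comp this)
  have h2 : Measurable fun p : ℝ≥0 × (ℝ≥0 → EuclideanSpace ℝ (Fin d)) =>
      (⌊(n : ℝ≥0) * p.1⌋₊, p.2) :=
    (Nat.measurable_floor.comp (measurable_fst.const_mul _)).prodMk measurable_snd
  exact h1.comp h2

lemma pathEval_eq (r : ℝ≥0) {w : ℝ≥0 → EuclideanSpace ℝ (Fin d)}
    (hw : ∀ i, Continuous fun t => w t i) : pathEval (r, w) = w r := by
  ext i
  refine Filter.Tendsto.limsup_eq (((hw i).tendsto r).comp ?_)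
  have h := (tendsto_nat_floor_mul_div_atTop (R := ℝ) r.2).comp
    (tendsto_natCast_atTop_atTop (R := ℝ))
  rw [← NNReal.tendsto_coe]
  refine h.congr fun n => ?_
  simp only [Function.comp, NNReal.coe_div, NNReal.coe_natCast]
  congr 2
  rw [mul_comm (n : ℝ≥0) r]
  exact Nonneg.nat_floor_coe (r * (n : ℝ≥0))

lemma IsStandardBrownianMotion.ae_continuous {W : ℝ≥0 → Ω → EuclideanSpace ℝ (Fin d)}
    (hW : IsStandardBrownianMotion W P) : ∀ᵐ ω ∂P, ∀ i, Continuous fun t => W t ω i :=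
  ae_all_iff.2 fun i => (hW.coord i).cont

/-- Independence of the coordinates gives the joint law from the marginals; characteristic functions
then absorb both scalings. -/
lemma IsStandardBrownianMotion.map_smul_apply [IsProbabilityMeasure P]
    {W : ℝ≥0 → Ω → EuclideanSpace ℝ (Fin d)}
    (hW : IsStandardBrownianMotion W P) (r : ℝ≥0) :
    P.map (fun ω => √2 • W r ω)
      = (stdGaussian (EuclideanSpace ℝ (Fin d))).map fun z => √(2 * r) • z := by
  have hm : ∀ i, Measurable fun ω => W r ω i := fun i => by
    have := hW.measurable r
    fun_prop
  have h1 : iIndepFun (fun i ω => W r ω i) P :=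
    hW.indep.comp (fun _ w => w r) fun _ => measurable_pi_apply r
  have h2 := (iIndepFun_iff_map_fun_eq_pi_map fun i => (hm i).aemeasurable).1 h1
  have h3 : ∀ i, P.map (fun ω => W r ω i) = gaussianReal 0 r := fun i =>
    ((hW.coord i).hasLaw_eval r).map_eq
  simp only [h3] at h2
  have h4 : (fun ω => √2 • W r ω) = (fun z : EuclideanSpace ℝ (Fin d) => √2 • z) ∘
      (WithLp.toLp 2 : (Fin d → ℝ) → EuclideanSpace ℝ (Fin d)) ∘ fun ω i => W r ω i := rfl
  rw [h4, ← Measure.map_map (measurable_const_smul √2)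
    ((WithLp.measurable_toLp 2 _).comp (measurable_pi_lambda _ hm)),
    ← Measure.map_map (WithLp.measurable_toLp 2 _) (measurable_pi_lambda _ hm), h2]
  have := Measure.isProbabilityMeasure_map (μ := Measure.pi fun _ : Fin d => gaussianReal 0 r)
    (f := (WithLp.toLp 2 : (Fin d → ℝ) → EuclideanSpace ℝ (Fin d)))
    (WithLp.measurable_toLp 2 _).aemeasurable
  have := Measure.isProbabilityMeasure_map
    (μ := (Measure.pi fun _ : Fin d => gaussianReal 0 r).map
      (WithLp.toLp 2 : (Fin d → ℝ) → EuclideanSpace ℝ (Fin d)))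
    (f := fun z : EuclideanSpace ℝ (Fin d) => √2 • z) (by fun_prop)
  have := Measure.isProbabilityMeasure_map
    (μ := stdGaussian (EuclideanSpace ℝ (Fin d)))
    (f := fun z : EuclideanSpace ℝ (Fin d) => √(2 * r) • z) (by fun_prop)
  apply Measure.ext_of_charFun
  ext t
  rw [charFun_map_smul, charFun_map_smul, charFun_stdGaussian, charFun_pi]
  simp_rw [charFun_gaussianReal, ← Complex.exp_sum]
  congr 1
  have h5 : ‖√(2 * (r : ℝ)) • t‖ ^ 2 = 2 * r * ∑ i, t i ^ 2 := by
    rw [norm_smul, mul_pow, Real.norm_of_nonneg (Real.sqrt_nonneg _),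
      Real.sq_sqrt (by positivity), EuclideanSpace.real_norm_sq_eq]
  have h6 : ∀ i, (√2 • t) i ^ 2 = 2 * t i ^ 2 := fun i => by
    rw [PiLp.smul_apply, smul_eq_mul, mul_pow, Real.sq_sqrt (by norm_num)]
  rw [← Complex.ofReal_pow, h5]
  simp_rw [← Complex.ofReal_pow, h6]
  push_cast
  rw [Finset.mul_sum, ← Finset.sum_neg_distrib, Finset.sum_div]
  exact Finset.sum_congr rfl fun i _ => by ring

/-- Standard Brownian motion at an independent random time. -/
lemma map_pathEval [IsProbabilityMeasure P] {W : ℝ≥0 → Ω → EuclideanSpace ℝ (Fin d)}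
    {X : Ω → ℝ≥0} (hW : IsStandardBrownianMotion W P) (hX : Measurable X)
    (hXW : IndepFun X (fun ω t => W t ω) P) :
    P.map (fun ω => √2 • pathEval (X ω, fun t => W t ω))
      = ((P.map fun ω => (X ω : ℝ)).prod (stdGaussian (EuclideanSpace ℝ (Fin d)))).map
          fun p => √(2 * p.1) • p.2 := by
  have hWm : Measurable fun ω t => W t ω := measurable_pi_lambda _ hW.measurable
  have hX' : Measurable fun ω => (X ω : ℝ) := hX.coe_nnreal_real
  have := Measure.isProbabilityMeasure_map hX'.aemeasurable (μ := P)
  have hev : Measurable fun p : ℝ≥0 × (ℝ≥0 → EuclideanSpace ℝ (Fin d)) => √2 • pathEval p :=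
    (measurable_const_smul √2).comp measurable_pathEval
  have hprod := (indepFun_iff_map_prod_eq_prod_map_map hX.aemeasurable hWm.aemeasurable).1 hXW
  have hsm : Measurable fun p : ℝ × EuclideanSpace ℝ (Fin d) => √(2 * p.1) • p.2 := by fun_prop
  ext s hs
  have h0 : (fun ω => √2 • pathEval (X ω, fun t => W t ω))
      = (fun p => √2 • pathEval p) ∘ fun ω => (X ω, fun t => W t ω) := rfl
  rw [h0, ← Measure.map_map hev (hX.prodMk hWm), hprod, Measure.map_apply hev hs,
    Measure.prod_apply (hev hs), Measure.map_apply hsm hs, Measure.prod_apply (hsm hs),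
    lintegral_map (measurable_measure_prodMk_left (hev hs)) hX,
    lintegral_map (measurable_measure_prodMk_left (hsm hs)) hX']
  -- The time is now frozen at `X ω`, so path continuity replaces `pathEval` by `W` almost surely
  -- and the fixed-time law applies.
  refine lintegral_congr fun ω => ?_
  have h1 := congrArg (fun ν => ν s) (hW.map_smul_apply (X ω))
  simp only at h1
  have h2 : Measurable fun ω' => √2 • W (X ω) ω' :=
    (measurable_const_smul √2).comp (hW.measurable (X ω))
  rw [Measure.map_apply h2 hs, Measure.map_apply (by fun_prop) hs]
    at h1
  rw [Measure.map_apply hWm (measurable_prodMk_left (hev hs))]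
  refine Eq.trans (measure_congr ?_) h1
  filter_upwards [hW.ae_continuous] with ω' h'
  refine propext ?_
  change √2 • pathEval (X ω, fun t => W t ω') ∈ s ↔ √2 • W (X ω) ω' ∈ s
  rw [pathEval_eq _ h']

/-- Laws on the line are determined by their upper tails. Thresholds `a ≤ 0` are not covered by the
hypothesis, but there both laws give full mass. -/
lemma map_coe_eq_expMeasure [IsProbabilityMeasure P] {lam : ℝ} (hlam : 0 < lam) {X : Ω → ℝ≥0}
    (hX : Measurable X)
    (h : ∀ ε : ℝ, 0 < ε → P {ω | ε ≤ (X ω : ℝ)} = ENNReal.ofReal (Real.exp (-lam * ε))) :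
    P.map (fun ω => (X ω : ℝ)) = expMeasure lam := by
  have hX' : Measurable fun ω => (X ω : ℝ) := hX.coe_nnreal_real
  have := Measure.isProbabilityMeasure_map hX'.aemeasurable (μ := P)
  have := isProbabilityMeasure_expMeasure hlam
  refine Measure.ext_of_Ici _ _ fun a => ?_
  rw [Measure.map_apply hX' measurableSet_Ici]
  rcases le_or_gt a 0 with ha | ha
  · have h1 : (fun ω => (X ω : ℝ)) ⁻¹' Set.Ici a = Set.univ :=
      Set.eq_univ_of_forall fun ω => ha.trans (X ω).2
    rw [h1, measure_univ, eq_comm, ← mem_ae_iff_prob_eq_one measurableSet_Ici]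
    filter_upwards [ae_nonneg_expMeasure lam] with t ht using ha.trans ht
  · refine (h a ha).trans ?_
    have h1 : (expMeasure lam).real (Set.Ici a) = Real.exp (-lam * a) := by
      rw [← integral_indicator_one measurableSet_Ici, integral_expMeasure hlam]
      have h2 : ∀ t, lam * Real.exp (-(lam * t)) * (Set.Ici a).indicator 1 t
          = (Set.Ici a).indicator (fun t => lam * Real.exp (-lam * t)) t := fun t => by
        by_cases ht : t ∈ Set.Ici a <;> simp [ht]
      simp_rw [h2]
      rw [setIntegral_indicator measurableSet_Ici,
        Set.inter_eq_right.2 (Set.Ici_subset_Ioi.2 ha), integral_Ici_eq_integral_Ioi,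
        integral_const_mul, integral_exp_mul_Ioi (by linarith)]
      field_simp
    rw [← h1, Measure.real, ENNReal.ofReal_toReal (measure_ne_top _ _)]

/-- The increments `√2 W_R` agree almost surely with independent random variables whose law is the
resolvent measure. -/
lemma exists_iIndepFun_increments [IsProbabilityMeasure P] {ι : Type*} [Countable ι] {lam : ℝ}
    {W : ι → ℝ≥0 → Ω → EuclideanSpace ℝ (Fin d)} {R : ι → Ω → ℝ≥0}
    (hW : ∀ i, IsStandardBrownianMotion (W i) P)
    (hW_indep : iIndepFun (fun i ω t => W i t ω) P)
    (hR_meas : ∀ i, Measurable (R i)) (hR_indep : iIndepFun R P)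
    (hR_law : ∀ i, P.map (fun ω => (R i ω : ℝ)) = expMeasure lam)
    (hRW : IndepFun (fun ω i => R i ω) (fun ω i t => W i t ω) P) :
    ∃ Y : ι → Ω → EuclideanSpace ℝ (Fin d), (∀ i, Measurable (Y i)) ∧
      (∀ᵐ ω ∂P, ∀ i, √2 • W i (R i ω) ω = Y i ω) ∧ iIndepFun Y P ∧
      ∀ i, P.map (Y i) = resolventMeasure lam d := by
  have hev : Measurable fun p : ℝ≥0 × (ℝ≥0 → EuclideanSpace ℝ (Fin d)) => √2 • pathEval p :=
    (measurable_const_smul √2).comp measurable_pathEval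
  have hWm : ∀ i, Measurable fun ω t => W i t ω := fun i =>
    measurable_pi_lambda _ (hW i).measurable
  refine ⟨fun i ω => √2 • pathEval (R i ω, fun t => W i t ω), fun i =>
    hev.comp ((hR_meas i).prodMk (hWm i)), ?_, ?_, fun i => ?_⟩
  · filter_upwards [ae_all_iff.2 fun i => (hW i).ae_continuous] with ω h i
    rw [pathEval_eq _ (h i)]
  · exact (iIndepFun_prodMk hR_meas hWm hR_indep hW_indep hRW).comp _ fun _ => hev
  · rw [map_pathEval (hW i) (hR_meas i) (hRW.comp (measurable_pi_apply i)
      (measurable_pi_apply i)), hR_law i, resolventMeasure]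

end noise

end EllipticMLP

namespace EllipticMLP

/-! ### The error of the scheme -/

section error

variable {d : ℕ}

/-- Transfers the scheme to the canonical product space. One null set serves all `n` and `x`, since
the almost sure identity concerns only the countably many increments. -/
lemma IsMLPScheme.exists_noise {Ω : Type*} [MeasurableSpace Ω] {P : Measure Ω}
    [IsProbabilityMeasure P] {lam : ℝ} [IsProbabilityMeasure (resolventMeasure lam d)] {M : ℕ}
    {f : EuclideanSpace ℝ (Fin d) → ℝ → ℝ}
    {W : Index → ℝ≥0 → Ω → EuclideanSpace ℝ (Fin d)} {R : Index → Ω → ℝ≥0}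
    {U : Index → ℕ → EuclideanSpace ℝ (Fin d) → Ω → ℝ} (hlam : lam ≠ 0)
    (hU : IsMLPScheme lam M f W R U) (hW : ∀ θ, IsStandardBrownianMotion (W θ) P)
    (hW_indep : iIndepFun (fun θ ω t => W θ t ω) P)
    (hR_meas : ∀ θ, Measurable (R θ)) (hR_indep : iIndepFun R P)
    (hR_law : ∀ θ, P.map (fun ω => (R θ ω : ℝ)) = expMeasure lam)
    (hRW : IndepFun (fun ω θ => R θ ω) (fun ω θ t => W θ t ω) P) (θ : Index) :
    ∃ Y : Ω → Index → EuclideanSpace ℝ (Fin d),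
      MeasurePreserving Y P (Measure.infinitePi fun _ => resolventMeasure lam d) ∧
      ∀ᵐ ω ∂P, ∀ n x, U θ n x ω = mlp M (fun y v => v - f y v / lam) n x (Y ω) := by
  obtain ⟨Y, hYm, hYW, hYi, hYl⟩ :=
    exists_iIndepFun_increments hW hW_indep hR_meas hR_indep hR_law hRW
  let g : Index → Index := fun l => ⟨θ.1 ++ l.1, by simp [l.2]⟩
  have hg : g.Injective := fun l l' h => by
    have h' := congrArg Subtype.val h
    exact Subtype.ext (List.append_cancel_left h')
  refine ⟨fun ω l => Y (g l) ω, ⟨measurable_pi_lambda _ fun l => hYm _, ?_⟩, ?_⟩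
  · have h := (hYi.precomp hg).map_fun_eq_infinitePi_map fun l => hYm (g l)
    simp only [hYl] at h
    exact h
  · filter_upwards [hYW] with ω h n x
    rw [hU.eq_mlp hlam]
    congr 1
    funext l
    exact h (g l)

/-- The equation bounds `Δu` through `|f y (u y)| ≤ |f y 0| + (lam + L) |u y|`, so no growth
assumption on derivatives of `u` is required. -/
lemma eq_integral_of_laplacian_eq {u : EuclideanSpace ℝ (Fin d) → ℝ}
    {f : EuclideanSpace ℝ (Fin d) → ℝ → ℝ} {lam L ε C₁ K : ℝ} (hu : ContDiff ℝ 2 u)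
    (hpde : ∀ x, Laplacian.laplacian u x = f x (u x)) (hlam : 0 < lam) (hL : 0 ≤ L)
    (hlip : ∀ x v w, |f x v - f x w - lam * (v - w)| ≤ L * |v - w|)
    (hε0 : 0 ≤ ε) (hε : ε ^ 2 < lam) (hf0 : ∀ x, |f x 0| ≤ C₁ * weight ε x)
    (huK : ∀ x, |u x| ≤ K * weight ε x) (x : EuclideanSpace ℝ (Fin d)) :
    u x = ∫ y, (u (x + y) - f (x + y) (u (x + y)) / lam) ∂(resolventMeasure lam d) := by
  rw [eq_integral_resolventMeasure hu hlam hε0 hε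
    (K := K + (C₁ + (lam + L) * K)) (fun y => ?_) (fun y => ?_) x]
  · simp only [hpde]
  · have h0 := (abs_nonneg _).trans (hf0 y)
    have h1 := (abs_nonneg _).trans (huK y)
    have h2 := huK y
    have h3 : 0 ≤ (lam + L) * (K * weight ε y) := by positivity
    linarith
  · have h0 := hf0 y
    have h1 := huK y
    have h2 := hlip y (u y) 0
    have h3 : (lam + L) * |u y| ≤ (lam + L) * (K * weight ε y) := by gcongr
    have h4 : |f y (u y)| ≤ |f y (u y) - f y 0 - lam * (u y - 0)| + |f y 0| + lam * |u y| := by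
      calc |f y (u y)| = |(f y (u y) - f y 0 - lam * (u y - 0)) + f y 0 + lam * u y| := by
            congr 1; ring
        _ ≤ _ := (abs_add_three _ _ _).trans_eq (by rw [abs_mul, abs_of_pos hlam])
    have h5 := (abs_nonneg _).trans h1
    rw [sub_zero] at h2 h4
    rw [hpde]
    linarith

/-- Apply `s ≤ exp s` to `s = δ (1 + |t|)` and raise to the power `p`. Dividing by `p + 1` in `δ`
gives `δ p ≤ ε` and also covers `p = 0`. -/
lemma one_add_rpow_le_cosh {ε p : ℝ} (hε : 0 < ε) (hp : 0 ≤ p) :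
    ∃ K, 0 ≤ K ∧ ∀ t, (1 + |t|) ^ p ≤ K * Real.cosh (ε * t) := by
  set δ := ε / (p + 1) with hδ
  have hδ0 : 0 < δ := by positivity
  have hδp : δ * p ≤ ε := by
    rw [hδ, div_mul_eq_mul_div, div_le_iff₀ (by positivity)]; nlinarith
  refine ⟨2 * (δ⁻¹ ^ p * Real.exp ε), by positivity, fun t => ?_⟩
  have h1 : 1 + |t| ≤ δ⁻¹ * Real.exp (δ * (1 + |t|)) := by
    have := Real.add_one_le_exp (δ * (1 + |t|))
    rw [← div_eq_inv_mul, le_div_iff₀ hδ0]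
    linarith
  calc (1 + |t|) ^ p ≤ (δ⁻¹ * Real.exp (δ * (1 + |t|))) ^ p := by gcongr
    _ = δ⁻¹ ^ p * Real.exp (δ * p * (1 + |t|)) := by
      rw [Real.mul_rpow (by positivity) (by positivity), ← Real.exp_mul]
      congr 2; ring
    _ ≤ δ⁻¹ ^ p * Real.exp (ε * (1 + |t|)) := by gcongr
    _ = δ⁻¹ ^ p * Real.exp ε * Real.exp |ε * t| := by
      rw [mul_add, mul_one, Real.exp_add, abs_mul, abs_of_pos hε, mul_assoc]
    _ ≤ δ⁻¹ ^ p * Real.exp ε * (2 * Real.cosh (ε * t)) := by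
      gcongr; exact exp_abs_le_two_mul_cosh _
    _ = _ := by ring

lemma cosh_le_weight (ε : ℝ) (x : EuclideanSpace ℝ (Fin d)) (j : Fin d) :
    Real.cosh (ε * x j) ≤ weight ε x :=
  Finset.single_le_sum (f := fun j => Real.cosh (ε * x j)) (fun _ _ => (Real.cosh_pos _).le)
    (Finset.mem_univ j)

lemma exists_sum_abs_le (hd : 0 < d) (x : EuclideanSpace ℝ (Fin d)) :
    ∃ j, ∑ i, |x i| ≤ d * |x j| := by
  have : Nonempty (Fin d) := ⟨⟨0, hd⟩⟩
  obtain ⟨j, hj⟩ := Finite.exists_max fun i => |x i|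
  exact ⟨j, (Finset.sum_le_card_nsmul _ _ _ fun i _ => hj i).trans_eq (by simp)⟩

lemma one_le_weight (hd : 0 < d) (ε : ℝ) (x : EuclideanSpace ℝ (Fin d)) : 1 ≤ weight ε x :=
  (Real.one_le_cosh _).trans (cosh_le_weight ε x ⟨0, hd⟩)

lemma sqrt_weight_le (hd : 0 < d) (ε : ℝ) (x : EuclideanSpace ℝ (Fin d)) :
    √(weight ε x) ≤ weight ε x :=
  (Real.sqrt_le_left (weight_nonneg ε x)).2 (le_self_pow₀ (one_le_weight hd ε x) two_ne_zero)

/-- The largest coordinate controls the sum at the price of a factor `d`, and a single `cosh` is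
below the weight. Thus `K` is one-dimensional and the dimension enters only as `d ^ c`. -/
lemma one_add_sum_rpow_le (hd : 0 < d) {ε c K : ℝ} (hc : 0 ≤ c) (hK0 : 0 ≤ K)
    (hK : ∀ t, (1 + |t|) ^ (2 * c) ≤ K * Real.cosh (ε * t)) (x : EuclideanSpace ℝ (Fin d)) :
    (1 + ∑ j, |x j|) ^ c ≤ √K * (d : ℝ) ^ c * √(weight ε x) := by
  obtain ⟨j, hj⟩ := exists_sum_abs_le hd x
  have hd1 : (1 : ℝ) ≤ d := by exact_mod_cast hd
  have h0 : 0 ≤ ∑ j, |x j| := Finset.sum_nonneg fun _ _ => abs_nonneg _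
  have h1 : (1 + |x j|) ^ c ≤ √(K * weight ε x) := by
    refine Real.le_sqrt_of_sq_le ?_
    rw [← Real.rpow_natCast, ← Real.rpow_mul (by positivity)]
    calc (1 + |x j|) ^ (c * (2 : ℕ)) = (1 + |x j|) ^ (2 * c) := by congr 1; push_cast; ring
      _ ≤ K * Real.cosh (ε * x j) := hK _
      _ ≤ _ := by gcongr; exact cosh_le_weight ε x j
  calc (1 + ∑ j, |x j|) ^ c ≤ (d * (1 + |x j|)) ^ c := by gcongr; linarith
    _ = (d : ℝ) ^ c * (1 + |x j|) ^ c := Real.mul_rpow (by positivity) (by positivity)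
    _ ≤ (d : ℝ) ^ c * √(K * weight ε x) := by gcongr
    _ = _ := by rw [Real.sqrt_mul hK0]; ring

/-- The rate `ε / (2 d)` compensates for the sum of `d` coordinates and for the square root. The
constant depends on `d` without control, which is harmless as it disappears from the final estimate.
-/
lemma exists_abs_le_sqrt_weight (hd : 0 < d) {u : EuclideanSpace ℝ (Fin d) → ℝ} {ε : ℝ}
    (hε : 0 < ε)
    (hu : ∀ δ : ℝ, 0 < δ → BddAbove (Set.range fun y => |u y| * Real.exp (-δ * ∑ j, |y j|))) :
    ∃ K, 0 ≤ K ∧ ∀ x, |u x| ≤ K * √(weight ε x) := by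
  have hd1 : (0 : ℝ) < d := by exact_mod_cast hd
  obtain ⟨B, hB⟩ := hu (ε / (2 * d)) (by positivity)
  have hB' : ∀ y, |u y| * Real.exp (-(ε / (2 * d)) * ∑ j, |y j|) ≤ B :=
    fun y => hB (Set.mem_range_self y)
  have hB0 : 0 ≤ B := le_trans (by positivity) (hB' 0)
  refine ⟨B * √2, by positivity, fun x => ?_⟩
  obtain ⟨j, hj⟩ := exists_sum_abs_le hd x
  have h1 : Real.exp (ε / (2 * d) * ∑ j, |x j|) ≤ √(2 * weight ε x) := by
    refine Real.le_sqrt_of_sq_le ?_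
    rw [← Real.exp_nat_mul]
    calc Real.exp ((2 : ℕ) * (ε / (2 * d) * ∑ j, |x j|)) ≤ Real.exp |ε * x j| := by
          gcongr
          rw [abs_mul, abs_of_pos hε]
          calc ((2 : ℕ) : ℝ) * (ε / (2 * d) * ∑ j, |x j|)
              ≤ (2 : ℕ) * (ε / (2 * d) * (d * |x j|)) := by gcongr
            _ = ε * |x j| := by push_cast; field_simp
      _ ≤ 2 * Real.cosh (ε * x j) := exp_abs_le_two_mul_cosh _
      _ ≤ _ := by gcongr; exact cosh_le_weight ε x j
  calc |u x| = |u x| * Real.exp (-(ε / (2 * d)) * ∑ j, |x j|)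
        * Real.exp (ε / (2 * d) * ∑ j, |x j|) := by
        rw [mul_assoc, ← Real.exp_add]; simp
    _ ≤ B * √(2 * weight ε x) := by gcongr; exact hB' x
    _ = _ := by rw [Real.sqrt_mul (by norm_num)]; ring

lemma weight_le_of_mem_Icc {ε c : ℝ} {x : EuclideanSpace ℝ (Fin d)}
    (hx : ∀ j, x j ∈ Set.Icc (-c) c) : weight ε x ≤ d * Real.cosh (ε * c) := by
  refine (Finset.sum_le_card_nsmul _ _ (Real.cosh (ε * c)) fun j _ => ?_).trans_eq (by simp)
  rw [Real.cosh_le_cosh, abs_mul, abs_mul]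
  exact mul_le_mul_of_nonneg_left ((abs_le.2 (hx j)).trans (le_abs_self c)) (abs_nonneg ε)

end error

/-! ### Rates -/

/-- At `ε = 0` the condition reads `(1 + 1 / √M)(1 + L / lam) < 2`, that is, `lam + L < √M (lam -
L)`. It is strict and continuous in `ε`, so it survives for small positive `ε`. -/
lemma exists_weight_parameter {lam L : ℝ} (hL : 0 ≤ L) (hlam : L < lam) {M : ℕ}
    (hM : (√lam + √L) ^ 2 / (√lam - √L) ^ 2 < (M : ℝ)) :
    0 < M ∧ ∃ ε : ℝ, 0 < ε ∧ ε ^ 2 < lam ∧ L / lam * √(lam / (lam - ε ^ 2)) < 1 ∧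
      (1 + (√M)⁻¹) * (1 + L / lam * √(lam / (lam - ε ^ 2))) - 1 < 1 := by
  have hlam0 : 0 < lam := hL.trans_lt hlam
  have hl : 0 < √lam := Real.sqrt_pos.2 hlam0
  have hs : 0 ≤ √L := Real.sqrt_nonneg L
  have hls : √L < √lam := Real.sqrt_lt_sqrt hL hlam
  have hlsq : √lam ^ 2 = lam := Real.sq_sqrt hlam0.le
  have hssq : √L ^ 2 = L := Real.sq_sqrt hL
  have hM0 : (0 : ℝ) < M := lt_of_le_of_lt (by positivity) hM
  have hw : 0 < √(M : ℝ) := Real.sqrt_pos.2 hM0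
  have h1 : √lam + √L < √M * (√lam - √L) := by
    have h2 : (√lam + √L) ^ 2 < (√M * (√lam - √L)) ^ 2 := by
      rw [mul_pow, Real.sq_sqrt hM0.le]
      exact (div_lt_iff₀ (by have : 0 < √lam - √L := by linarith
                             positivity)).1 hM
    exact lt_of_pow_lt_pow_left₀ 2 (mul_nonneg hw.le (by linarith)) h2
  -- Multiplying by `√lam + √L` gives the stronger bound with `(√lam + √L) ^ 2` on the left; the
  -- cross term `2 √lam √L` is dropped.
  have h2 : lam + L < √M * (lam - L) := by
    have h3 := mul_lt_mul_of_pos_right h1 (by linarith : 0 < √lam + √L)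
    nlinarith [mul_nonneg hl.le hs]
  have h3 : (1 + (√M)⁻¹) * (1 + L / lam) < 2 := by
    have : (1 + (√M)⁻¹) * (1 + L / lam) = (√M + 1) * (lam + L) / (√M * lam) := by
      field_simp
    rw [this, div_lt_iff₀ (by positivity)]
    nlinarith
  refine ⟨by exact_mod_cast hM0, ?_⟩
  have hcont : ContinuousAt
      (fun ε : ℝ => (1 + (√M)⁻¹) * (1 + L / lam * √(lam / (lam - ε ^ 2)))) 0 := by
    have : ContinuousAt (fun ε : ℝ => lam / (lam - ε ^ 2)) 0 :=
      ContinuousAt.div (by fun_prop) (by fun_prop) (by simp [hlam0.ne'])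
    fun_prop
  have hev1 : ∀ᶠ ε : ℝ in nhds 0,
      (1 + (√M)⁻¹) * (1 + L / lam * √(lam / (lam - ε ^ 2))) < 2 :=
    hcont.eventually_lt_const (by simpa [hlam0.ne'] using h3)
  have hev2 : ∀ᶠ ε : ℝ in nhds 0, ε ^ 2 < lam :=
    (continuous_pow 2).continuousAt.eventually_lt_const (by simpa using hlam0)
  obtain ⟨ε, ⟨h4, h5⟩, h6⟩ :=
    (((hev1.and hev2).filter_mono nhdsWithin_le_nhds).and
      (self_mem_nhdsWithin (s := Set.Ioi (0 : ℝ)))).exists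
  have h7 : 0 < (√(M : ℝ))⁻¹ := by positivity
  have h8 : 0 ≤ L / lam * √(lam / (lam - ε ^ 2)) := by positivity
  exact ⟨ε, h6, h5, by nlinarith, by linarith⟩

lemma one_add_sum_three_mul_four_pow_le (n : ℕ) :
    1 + ∑ k ∈ Finset.Ico 1 n, 3 * (4 : ℝ) ^ k ≤ 4 ^ n := by
  induction n with
  | zero => simp
  | succ n ih =>
    rcases Nat.eq_zero_or_pos n with rfl | hn
    · norm_num
    · rw [Finset.sum_Ico_succ_top hn, pow_succ]
      linarith

/-- After factoring out `M ^ n`, each of the three summands is at most `a 4 ^ k`, and `1 + ∑ 3 · 4 ^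
k ≤ 4 ^ n`. -/
lemma cost_le {M : ℕ} (hM : 0 < M) {a : ℝ} (ha : 0 ≤ a) {C : ℕ → ℝ}
    (hC : ∀ n : ℕ, C n ≤ a * (M : ℝ) ^ n
      + ∑ k ∈ Finset.Ico 1 n, (M : ℝ) ^ (n - k) * (a + C k + C (k - 1))) (n : ℕ) :
    C n ≤ a * (4 * M) ^ n := by
  have hM1 : (1 : ℝ) ≤ M := by exact_mod_cast hM
  induction n using Nat.strong_induction_on with
  | _ n ih =>
    refine (hC n).trans ?_
    calc a * (M : ℝ) ^ n + ∑ k ∈ Finset.Ico 1 n, (M : ℝ) ^ (n - k) * (a + C k + C (k - 1))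
        ≤ a * (M : ℝ) ^ n + ∑ k ∈ Finset.Ico 1 n, a * (M : ℝ) ^ n * (3 * 4 ^ k) := by
          refine add_le_add_right (Finset.sum_le_sum fun k hk => ?_) _
          obtain ⟨hk1, hkn⟩ := Finset.mem_Ico.1 hk
          have h1 := ih k hkn
          have h2 := ih (k - 1) (by omega)
          have h3 : (4 * (M : ℝ)) ^ (k - 1) ≤ (4 * M) ^ k :=
            pow_le_pow_right₀ (by linarith) (by omega)
          have h4 : (1 : ℝ) ≤ (4 * M) ^ k := one_le_pow₀ (by linarith)
          calc (M : ℝ) ^ (n - k) * (a + C k + C (k - 1))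
              ≤ (M : ℝ) ^ (n - k) * (a * (3 * (4 * M) ^ k)) := by
                gcongr
                have h5 := mul_le_mul_of_nonneg_left h3 ha
                have h6 := mul_le_mul_of_nonneg_left h4 ha
                linarith
            _ = a * ((M : ℝ) ^ (n - k) * M ^ k) * (3 * 4 ^ k) := by rw [mul_pow]; ring
            _ = _ := by rw [← pow_add, Nat.sub_add_cancel hkn.le]
      _ = a * (M : ℝ) ^ n * (1 + ∑ k ∈ Finset.Ico 1 n, 3 * (4 : ℝ) ^ k) := by
          rw [← Finset.mul_sum]; ring
      _ ≤ a * (M : ℝ) ^ n * 4 ^ n := by gcongr; exact one_add_sum_three_mul_four_pow_le n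
      _ = _ := by rw [mul_pow]; ring

/-- Exponential convergence at exponential cost is convergence at polynomial cost. -/
lemma exists_polynomial_rate {r B Q q : ℝ} (hr0 : 0 < r) (hr1 : r < 1) (hB : 1 ≤ B) (hQ : 1 ≤ Q)
    (hq : 0 ≤ q) :
    ∃ κ : ℝ, ∀ ε : ℝ, 0 < ε → ε ≤ 1 → ∀ x : ℝ, 1 ≤ x → ∃ n : ℕ, 0 < n ∧
      (x + 1) * B ^ n ≤ κ * x ^ κ * ε ^ (-κ) ∧ Q * x ^ q * r ^ n ≤ ε := by
  have ha : Real.log r < 0 := Real.log_neg hr0 hr1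
  have hlB : 0 ≤ Real.log B := Real.log_nonneg hB
  set s := Real.log B / (-Real.log r) with hs
  have hs0 : 0 ≤ s := div_nonneg hlB (by linarith)
  have hA0 : 0 ≤ 2 * B ^ 2 * Q ^ s := by positivity
  -- The sum of nonnegative quantities dominates at once the prefactor, the exponent of `x` and the
  -- exponent of `1 / ε`.
  refine ⟨2 * B ^ 2 * Q ^ s + (q * s + 1) + s, fun ε hε0 hε1 x hx => ?_⟩
  set κ := 2 * B ^ 2 * Q ^ s + (q * s + 1) + s with hκ
  have hqs : 0 ≤ q * s := mul_nonneg hq hs0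
  have hx0 : 0 < x := by linarith
  set T := Q * x ^ q / ε with hT
  have hT0 : 0 < T := by positivity
  have hT1 : 1 ≤ T := by
    rw [hT, le_div_iff₀ hε0, one_mul]
    exact hε1.trans (one_le_mul_of_one_le_of_one_le hQ (Real.one_le_rpow hx hq))
  have hlT : 0 ≤ Real.log T := Real.log_nonneg hT1
  set y := Real.log T / (-Real.log r) with hy
  have hy0 : 0 ≤ y := div_nonneg hlT (by linarith)
  -- `y` solves `r ^ y = 1 / T`, and then `B ^ y = T ^ s`. The extra `1` makes the level positive;
  -- it and the rounding cost at most `B ^ 2`.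
  refine ⟨⌈y⌉₊ + 1, Nat.succ_pos _, ?_, ?_⟩
  · have h1 : ((⌈y⌉₊ + 1 : ℕ) : ℝ) ≤ y + 2 := by
      push_cast; linarith [Nat.ceil_lt_add_one hy0]
    have h2 : B ^ (⌈y⌉₊ + 1) ≤ B ^ 2 * T ^ s := by
      calc B ^ (⌈y⌉₊ + 1) = B ^ ((⌈y⌉₊ + 1 : ℕ) : ℝ) := (Real.rpow_natCast _ _).symm
        _ ≤ B ^ (y + 2) := Real.rpow_le_rpow_of_exponent_le hB h1
        _ = B ^ 2 * T ^ s := by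
          rw [Real.rpow_add (by linarith), mul_comm]
          congr 1
          · exact Real.rpow_natCast B 2
          · rw [Real.rpow_def_of_pos (by linarith), Real.rpow_def_of_pos hT0, hs, hy]
            congr 1; ring
    have h3 : T ^ s = Q ^ s * x ^ (q * s) * ε ^ (-s) := by
      rw [hT, Real.div_rpow (by positivity) hε0.le, Real.mul_rpow (by positivity) (by positivity),
        ← Real.rpow_mul hx0.le, Real.rpow_neg hε0.le, div_eq_mul_inv]
    calc (x + 1) * B ^ (⌈y⌉₊ + 1) ≤ (2 * x) * (B ^ 2 * (Q ^ s * x ^ (q * s) * ε ^ (-s))) := by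
          rw [← h3]
          gcongr
          linarith
      _ = 2 * B ^ 2 * Q ^ s * x ^ (q * s + 1) * ε ^ (-s) := by
          rw [Real.rpow_add_one hx0.ne']; ring
      _ ≤ κ * x ^ κ * ε ^ (-κ) := by
          have h4 : ε ^ (-s) ≤ ε ^ (-κ) :=
            Real.rpow_le_rpow_of_exponent_ge hε0 hε1 (by linarith)
          have h5 : x ^ (q * s + 1) ≤ x ^ κ :=
            Real.rpow_le_rpow_of_exponent_le hx (by linarith)
          have h6 : 2 * B ^ 2 * Q ^ s ≤ κ := by linarith
          gcongr
  · have h1 : y ≤ ((⌈y⌉₊ + 1 : ℕ) : ℝ) := by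
      push_cast; linarith [Nat.le_ceil y]
    have h2 : r ^ (⌈y⌉₊ + 1) ≤ T⁻¹ := by
      calc r ^ (⌈y⌉₊ + 1) = r ^ ((⌈y⌉₊ + 1 : ℕ) : ℝ) := (Real.rpow_natCast _ _).symm
        _ ≤ r ^ y := Real.rpow_le_rpow_of_exponent_ge hr0 hr1.le h1
        _ = T⁻¹ := by
          rw [Real.rpow_def_of_pos hr0, ← Real.exp_log (inv_pos.2 hT0), Real.log_inv, hy]
          congr 1
          rw [div_neg, mul_neg, mul_div_cancel₀ _ ha.ne]
    calc Q * x ^ q * r ^ (⌈y⌉₊ + 1) ≤ Q * x ^ q * T⁻¹ := by gcongr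
      _ = ε := by rw [hT]; field_simp

end EllipticMLP

/-! ### Assembly of the main theorem -/

theorem theorem1p1
    (c L lam : ℝ) (hc : 0 ≤ c) (hL : 0 ≤ L) (hlam : L < lam)
    (M : ℕ) (hM : (√lam + √L) ^ 2 / (√lam - √L) ^ 2 < (M : ℝ))
    (u : (d : ℕ+) → EuclideanSpace ℝ (Fin d) → ℝ)
    (f : (d : ℕ+) → EuclideanSpace ℝ (Fin d) → ℝ → ℝ)
    (hu : ∀ d, ContDiff ℝ 2 (u d))
    (hf : ∀ d, Continuous (Function.uncurry (f d)))
    (hpde : ∀ d x, Laplacian.laplacian (u d) x = f d x (u d x))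
    (hf_lip : ∀ d x v w, |f d x v - f d x w - lam * (v - w)| ≤ L * |v - w|)
    (hf_growth : ∀ d x, |f d x 0| ≤ c * ((d : ℕ) : ℝ) ^ c * (1 + ∑ j, |x j|) ^ c)
    (hu_growth : ∀ d, ∀ ε : ℝ, 0 < ε →
      BddAbove (Set.range fun y => |u d y| * Real.exp (-ε * ∑ j, |y j|)))
    {Ω : Type*} [MeasurableSpace Ω] (P : Measure Ω) [IsProbabilityMeasure P]
    (W : (d : ℕ+) → EllipticMLP.Index → ℝ≥0 → Ω → EuclideanSpace ℝ (Fin d))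
    (R : EllipticMLP.Index → Ω → ℝ≥0)
    (hW : ∀ d θ, EllipticMLP.IsStandardBrownianMotion (W d θ) P)
    (hW_indep : ∀ d, iIndepFun (fun (θ : EllipticMLP.Index) (ω : Ω) (t : ℝ≥0) => W d θ t ω) P)
    (hR_meas : ∀ θ, Measurable (R θ))
    (hR_indep : iIndepFun R P)
    (hR_ident : ∀ θ, IdentDistrib (R θ) (R EllipticMLP.Index.zero) P P)
    (hR_law : ∀ ε : ℝ, 0 < ε →
      P {ω | ε ≤ (R EllipticMLP.Index.zero ω : ℝ)} = ENNReal.ofReal (Real.exp (-lam * ε)))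
    (hRW_indep : IndepFun (fun (ω : Ω) (θ : EllipticMLP.Index) => R θ ω)
      (fun (ω : Ω) (d : ℕ+) (θ : EllipticMLP.Index) (t : ℝ≥0) => W d θ t ω) P)
    (U : (d : ℕ+) → EllipticMLP.Index → ℕ → EuclideanSpace ℝ (Fin d) → Ω → ℝ)
    (hU : ∀ d, EllipticMLP.IsMLPScheme lam M (f d) (W d) R (U d))
    (C : ℕ → ℕ → ℝ)
    (hC : ∀ d n : ℕ, C d n ≤ ((d : ℝ) + 1) * (M : ℝ) ^ n
      + ∑ k ∈ Finset.Ico 1 n, (M : ℝ) ^ (n - k) * ((d : ℝ) + 1 + C d k + C d (k - 1))) :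
    ∃ (κ : ℝ) (N : Set.Ioc (0 : ℝ) 1 → ℕ+ → ℕ+),
      ∀ (ε : Set.Ioc (0 : ℝ) 1) (d : ℕ+),
        C d (N ε d) ≤ κ * ((d : ℕ) : ℝ) ^ κ * (ε : ℝ) ^ (-κ) ∧
        ∀ x : EuclideanSpace ℝ (Fin d), (∀ j, x j ∈ Set.Icc (-c) c) →
          MemLp (fun ω => u d x - U d EllipticMLP.Index.zero (N ε d) x ω) 2 P ∧
          (∫ ω, |u d x - U d EllipticMLP.Index.zero (N ε d) x ω| ^ 2 ∂P) ^ (1 / 2 : ℝ) ≤ ε := by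
  have hlam0 : 0 < lam := hL.trans_lt hlam
  obtain ⟨hM0, e, he0, he, hb, hr1⟩ := EllipticMLP.exists_weight_parameter hL hlam hM
  -- The exponent `2 c` appears because the growth of `f` is compared with the square root of the
  -- weight. `K` is fixed before the dimension.
  obtain ⟨K, hK0, hK⟩ := EllipticMLP.one_add_rpow_le_cosh he0 (p := 2 * c) (by positivity)
  set A := lam / (lam - e ^ 2) with hA
  have hA0 : 0 < A := div_pos hlam0 (by linarith)
  set b := L / lam * √A with hbdef
  have hb0 : 0 ≤ b := by positivity
  set r := (1 + (√(M : ℝ))⁻¹) * (1 + b) - 1 with hr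
  have hr0 : 0 < r := by
    have h1 : 0 < (√(M : ℝ))⁻¹ := inv_pos.2 (Real.sqrt_pos.2 (by exact_mod_cast hM0))
    nlinarith
  have h1b : 0 < 1 - b := by linarith
  set Q := c * √K / lam * √A / (1 - b) * √(Real.cosh (e * c)) with hQ
  have hQ0 : 0 ≤ Q := by positivity
  have hM1 : (1 : ℝ) ≤ M := by exact_mod_cast hM0
  -- In the exponent, one `c` comes from the growth assumption, the other from bounding the sum by
  -- the largest coordinate, and `1 / 2` from `√(d cosh (e c))` on the cube. Taking `Q + 1` ensures
  -- a prefactor of at least one.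
  obtain ⟨κ, hκ⟩ := EllipticMLP.exists_polynomial_rate (B := 4 * M) (Q := Q + 1)
    (q := c + c + 1 / 2) hr0 hr1 (by linarith) (by linarith) (by positivity)
  have hd1 : ∀ d : ℕ+, (1 : ℝ) ≤ (d : ℕ) := fun d => by exact_mod_cast d.2
  choose N hN0 hNC hNε using fun (ε : Set.Ioc (0 : ℝ) 1) (d : ℕ+) =>
    hκ ε.1 ε.2.1 ε.2.2 (d : ℕ) (hd1 d)
  refine ⟨κ, fun ε d => ⟨N ε d, hN0 ε d⟩, fun ε d => ⟨?_, fun x hx => ?_⟩⟩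
  · exact (EllipticMLP.cost_le hM0 (by positivity) (hC d) _).trans (hNC ε d)
  have hd0 : 0 < (d : ℕ) := d.2
  have := EllipticMLP.isProbabilityMeasure_resolventMeasure (d := d) hlam0
  have hR_exp : ∀ θ, P.map (fun ω => (R θ ω : ℝ)) = expMeasure lam := fun θ => by
    refine ((hR_ident θ).comp measurable_coe_nnreal_real).map_eq.trans ?_
    exact EllipticMLP.map_coe_eq_expMeasure hlam0 (hR_meas _) hR_law
  obtain ⟨Y, hY, hYU⟩ := (hU d).exists_noise hlam0.ne' (hW d) (hW_indep d) hR_meas hR_indep hR_exp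
    (hRW_indep.comp measurable_id (measurable_pi_apply d)) EllipticMLP.Index.zero
  obtain ⟨K', hK'0, hK'⟩ := EllipticMLP.exists_abs_le_sqrt_weight hd0 he0 (hu_growth d)
  have hfm : Measurable (Function.uncurry (f d)) := (hf d).measurable
  have hG : Measurable (Function.uncurry fun y v => v - f d y v / lam) :=
    measurable_snd.sub (hfm.div_const lam)
  have hum : Measurable (u d) := (hu d).continuous.measurable
  have hf0 : ∀ y, |f d y 0| ≤ c * √K * ((d : ℕ) : ℝ) ^ (c + c) * √(EllipticMLP.weight e y) :=
    fun y => by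
      refine (hf_growth d y).trans ?_
      calc c * ((d : ℕ) : ℝ) ^ c * (1 + ∑ j, |y j|) ^ c
          ≤ c * ((d : ℕ) : ℝ) ^ c
            * (√K * ((d : ℕ) : ℝ) ^ c * √(EllipticMLP.weight e y)) := by
            gcongr; exact EllipticMLP.one_add_sum_rpow_le hd0 hc hK0 hK y
        _ = _ := by rw [Real.rpow_add (by linarith [hd1 d])]; ring
  have hfix : ∀ y, u d y = ∫ z, (u d (y + z) - f d (y + z) (u d (y + z)) / lam)
      ∂(EllipticMLP.resolventMeasure lam d) := fun y =>
    EllipticMLP.eq_integral_of_laplacian_eq (hu d) (hpde d) hlam0 hL (hf_lip d) he0.le he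
      (C₁ := c * √K * ((d : ℕ) : ℝ) ^ (c + c)) (K := K')
      (fun y => (hf0 y).trans (by gcongr; exact EllipticMLP.sqrt_weight_le hd0 e y))
      (fun y => (hK' y).trans (by gcongr; exact EllipticMLP.sqrt_weight_le hd0 e y)) y
  have hlip : ∀ y v w, |(v - f d y v / lam) - (w - f d y w / lam)| ≤ L / lam * |v - w| :=
    fun y v w => by
      have h1 : (v - f d y v / lam) - (w - f d y w / lam)
          = -(f d y v - f d y w - lam * (v - w)) / lam := by field_simp; ring
      rw [h1, abs_div, abs_neg, abs_of_pos hlam0, div_mul_eq_mul_div]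
      gcongr
      exact hf_lip d y v w
  have herr := EllipticMLP.eLpNorm_mlp_sub_le (M := M)
    (C₀ := c * √K * ((d : ℕ) : ℝ) ^ (c + c) / lam) (EllipticMLP.resolventMeasure lam d) hG hum
    (EllipticMLP.weight_nonneg e) hA0.le (by positivity) (by positivity) hK'0
    (fun y => (EllipticMLP.lintegral_weight_resolventMeasure hlam0 he y).le) hlip
    (fun y => by
      rw [zero_sub, abs_neg, abs_div, abs_of_pos hlam0, div_mul_eq_mul_div]
      gcongr
      exact hf0 y) hK' hfix hb hM0 (N ε d) x
  have hbound : c * √K * ((d : ℕ) : ℝ) ^ (c + c) / lam * √A / (1 - b) * r ^ N ε d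
      * √(EllipticMLP.weight e x) ≤ ε := by
    refine le_trans ?_ (hNε ε d)
    calc _ ≤ c * √K * ((d : ℕ) : ℝ) ^ (c + c) / lam * √A / (1 - b) * r ^ N ε d
          * √((d : ℕ) * Real.cosh (e * c)) := by
          gcongr; exact EllipticMLP.weight_le_of_mem_Icc hx
      _ = Q * ((d : ℕ) : ℝ) ^ (c + c + 1 / 2) * r ^ N ε d := by
          rw [Real.sqrt_mul (by positivity), Real.sqrt_eq_rpow ((d : ℕ) : ℝ),
            Real.rpow_add (by linarith [hd1 d]) (c + c), hQ]
          ring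
      _ ≤ _ := by gcongr; linarith
  have hmeas : Measurable fun s : EllipticMLP.Index → EuclideanSpace ℝ (Fin d) =>
      EllipticMLP.mlp M (fun y v => v - f d y v / lam) (N ε d) x s - u d x :=
    ((EllipticMLP.measurable_mlp hG _).comp measurable_prodMk_left).sub_const _
  -- The error of the scheme is, up to sign, the canonical error composed with the measure
  -- preserving `Y`, so both have the same `L²` norm.
  have hae : (fun ω => u d x - U d EllipticMLP.Index.zero (N ε d) x ω) =ᵐ[P]
      -((fun s => EllipticMLP.mlp M (fun y v => v - f d y v / lam) (N ε d) x s - u d x) ∘ Y) := by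
    filter_upwards [hYU] with ω h
    simp [h]
  have hnorm : eLpNorm (fun ω => u d x - U d EllipticMLP.Index.zero (N ε d) x ω) 2 P
      ≤ ENNReal.ofReal ε := by
    rw [eLpNorm_congr_ae hae, eLpNorm_neg,
      eLpNorm_comp_measurePreserving hmeas.aestronglyMeasurable hY]
    exact herr.trans (ENNReal.ofReal_le_ofReal hbound)
  have hsm : AEStronglyMeasurable
      (fun ω => u d x - U d EllipticMLP.Index.zero (N ε d) x ω) P :=
    (hmeas.comp hY.measurable).neg.aestronglyMeasurable.congr hae.symm
  refine ⟨⟨hsm, hnorm.trans_lt ENNReal.ofReal_lt_top⟩, ?_⟩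
  have hε0 : (0 : ℝ) ≤ ε := ε.2.1.le
  have hsq := EllipticMLP.integral_sq_le_of_eLpNorm_le hε0 hsm hnorm
  simp only [sq_abs]
  rw [← Real.sqrt_eq_rpow]
  exact (Real.sqrt_le_left hε0).2 hsq
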